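/- **Theorem (Sharing equality is linear).** *$\lambda$-DAGs.* A pre-$\lambda$-DAG $G$ is a directed graph with four kinds of nodes: applications $\mathrm{App}(n,m)$ with a left child $n$ and a right child $m$; abstractions $\mathrm{Abs}(n)$ with a body $n$; free variables, without children, each carrying an atom that identifies it uniquely; and bound variables $\mathrm{Var}(l)$, whose only child is their binder $l$, an abstraction node. Paths use left, right and body edges, but no binding edges. A *root* is a node such that the only path ending in it is the empty one. A *$\lambda$-DAG* is a finite pre-$\lambda$-DAG that is acyclic (no non-empty path from a node to itself) and dominated (every path from a root to a bound variable node $\mathrm{Var}(l)$ crosses $l$). Its size $|G|$ is the number of its nodes plus the number of its edges. A *query* $Q$ over $G$ is a binary relation on the roots of $G$; it is given as a list of pairs, and $|Q|$ is the length of that list. *Sharing equivalences.* Two nodes are homogeneous if both are applications, both abstractions, both free variables, or both bound variables. A *sharing equivalence* on $G$ is an equivalence relation $\equiv$ on the nodes that relates only homogeneous nodes and satisfies: $\mathrm{App}(n_1,n_2)\equiv\mathrm{App}(m_1,m_2)$ implies $n_1\equiv m_1$ and $n_2\equiv m_2$; $\mathrm{Abs}(n)\equiv\mathrm{Abs}(m)$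 implies $n\equiv m$; $\mathrm{Var}(l)\equiv\mathrm{Var}(l')$ implies $l\equiv l'$; and $v\equiv w$ implies $v=w$ for free variable nodes $v,w$. *The algorithm.* $G$ is stored with an array of its nodes and, for every node, an array of its parents (sources of left, right and body edges into it; a parent may be listed once per edge or only once), in arbitrary order. Every node has a linked list of its neighbours along undirected query edges $\sim$, and partially defined fields $\mathtt{canonic}$ (a node), $\mathtt{building}$ (a boolean) and $\mathtt{queue}$, all undefined at the start. The combined algorithm first creates one edge $n\sim m$ for each listed pair $(n,m)$ of $Q$ and then runs the following two checks in sequence; it *succeeds* if it terminates without executing *fail*. 1. *Blind check.* For every node $n$: if $\mathtt{canonic}(n)$ is undefined, call $\mathrm{BuildClass}(n)$. - $\mathrm{BuildClass}(c)$: set $\mathtt{canonic}(c):=c$, $\mathtt{building}(c):=\mathit{true}$, $\mathtt{queue}(c):=\{c\}$. While $\mathtt{queue}(c)$ is non-empty, pop a node $n$ from it and do the following. (i) For every parent $m$ of $n$: if $\mathtt{canonic}(m)$ is undefined, call $\mathrm{BuildClass}(m)$; otherwise fail if $\mathtt{building}(\mathtt{canonic}(m))$ is true. (ii) Then, for every $\sim$-neighbour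 $m$ of $n$: if $\mathtt{canonic}(m)$ is undefined, call $\mathrm{Enqueue}(m,c)$; otherwise fail if $\mathtt{canonic}(m)\neq c$. When the queue is empty, set $\mathtt{building}(c):=\mathit{false}$ and return. - $\mathrm{Enqueue}(m,c)$: if $m=\mathrm{Abs}(m')$ and $c=\mathrm{Abs}(c')$, create an edge $m'\sim c'$; if $m=\mathrm{App}(m_1,m_2)$ and $c=\mathrm{App}(c_1,c_2)$, create edges $m_1\sim c_1$ and $m_2\sim c_2$; if both are bound variables or both are free variables, do nothing; in all other cases fail. Then set $\mathtt{canonic}(m):=c$ and push $m$ to $\mathtt{queue}(c)$. 2. *Variables check.* For every variable node $v$ with $w:=\mathtt{canonic}(v)\neq v$: fail if $v$ or $w$ has no binder (i.e. is a free variable); otherwise fail if the binders of $v$ and $w$ have different $\mathtt{canonic}$ fields. The running time is the number of transitions, where a transition executes a single step of this code (an assignment, a branch, a loop iteration or exit) and consists of a bounded number of atomic operations on these data structures. *Statement.* There is a constant $C$ such that for every $\lambda$-DAG $G$ and every query $Q$ over $G$: - the combined algorithm terminates (in success or failure) after at most $C\cdot(|G|+|Q|+1)$ transitions; - it succeeds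 if and only if there exists a sharing equivalence on $G$ that contains $Q$; - if it succeeds, then in the final state every node $n$ has a defined canonic node $\mathtt{canonic}(n)$, with $\mathtt{canonic}(\mathtt{canonic}(n))=\mathtt{canonic}(n)$, so that there are at most $|G|$ canonic edges in total, and the relation "$\mathtt{canonic}(n)=\mathtt{canonic}(m)$" is the smallest sharing equivalence on $G$ containing $Q$. -/

import Mathlib

namespace SharingEquality

universe u v

/-! ## Lambda-DAGs -/

/-- The label of a node, together with its outgoing edges: application (left and right child),
abstraction (body), free variable (its atom), bound variable (its binder). -/
inductive Node (V : Type u) (A : Type v) : Type (max u v)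
  | app (left right : V)
  | abs (body : V)
  | fvar (atom : A)
  | bvar (binder : V)

namespace Node

variable {V : Type u} {A : Type v}

/-- Two nodes are homogeneous if they are of the same one of the four kinds. -/
def Homogeneous : Node V A → Node V A → Prop
  | app _ _, app _ _ => True
  | abs _, abs _ => True
  | fvar _, fvar _ => True
  | bvar _, bvar _ => True
  | _, _ => False

/-- The targets of the left, right and down edges (binding edges excluded), one entry per edge. -/
def children : Node V A → List V
  | app l r => [l, r]
  | abs b => [b]
  | fvar _ => []
  | bvar _ => []

/-- The binder of a variable node; it is undefined on free variables (and on non-variables). -/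
def binder : Node V A → Option V
  | bvar l => some l
  | _ => none

/-- `Var`-nodes, free or bound. -/
def isVar : Node V A → Bool
  | fvar _ => true
  | bvar _ => true
  | _ => false

/-- The number of outgoing edges, the binding edge of a bound variable included. -/
def outDegree : Node V A → ℕ
  | app _ _ => 2
  | abs _ => 1
  | fvar _ => 0
  | bvar _ => 1

end Node

/-- A pre-lambda-DAG with nodes `V` and atoms `A`: the binder of a bound variable is an
abstraction node, and the atom of a free variable node identifies that node. -/
structure PreLambdaDAG (V : Type u) (A : Type v) where
  node : V → Node V A
  binder_abs : ∀ w l, node w = Node.bvar l → ∃ b, node l = Node.abs b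
  atom_inj : ∀ w w' a, node w = Node.fvar a → node w' = Node.fvar a → w = w'

/-- Directions of the edges that paths may use. -/
inductive Dir
  | left
  | down
  | right

namespace PreLambdaDAG

variable {V : Type u} {A : Type v} (G : PreLambdaDAG V A)

/-- `G.Path τ n m`: there is a path from `n` to `m` of trace `τ`. The head of the list `τ` is the
last direction taken. Binding edges are not used. -/
inductive Path : List Dir → V → V → Prop
  | nil (n : V) : Path [] n n
  | down {τ : List Dir} {n m b : V} :
      Path τ n m → G.node m = Node.abs b → Path (Dir.down :: τ) n b
  | left {τ : List Dir} {n m m₁ m₂ : V} :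
      Path τ n m → G.node m = Node.app m₁ m₂ → Path (Dir.left :: τ) n m₁
  | right {τ : List Dir} {n m m₁ m₂ : V} :
      Path τ n m → G.node m = Node.app m₁ m₂ → Path (Dir.right :: τ) n m₂

/-- `G.Crosses τ n m`: the path of trace `τ` that starts in `n` crosses `m`. -/
inductive Crosses : List Dir → V → V → Prop
  | here {τ : List Dir} {n m : V} : G.Path τ n m → Crosses τ n m
  | step {τ : List Dir} {d : Dir} {n m p : V} :
      Crosses τ n m → G.Path (d :: τ) n p → Crosses (d :: τ) n m

/-- A root: the only path that ends in it is the empty one. -/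
def IsRoot (r : V) : Prop := ∀ (n : V) (τ : List Dir), G.Path τ n r → τ = []

/-- `G.Dominates m n`: every path from a root to `n` crosses `m`. -/
def Dominates (m n : V) : Prop :=
  ∀ (r : V) (τ : List Dir), G.IsRoot r → G.Path τ r n → G.Crosses τ r m

/-- A lambda-DAG is a finite, acyclic and dominated pre-lambda-DAG. -/
structure IsLambdaDAG : Prop where
  finite : Finite V
  acyclic : ∀ (n : V) (τ : List Dir), G.Path τ n n ↔ τ = []
  dominated : ∀ w l, G.node w = Node.bvar l → G.Dominates l w

/-- The size of `G`: number of nodes plus number of edges. -/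
def size [Fintype V] : ℕ := Fintype.card V + ∑ n : V, (G.node n).outDegree

/-- A query is a binary relation over the root nodes. -/
def IsQuery (Q : V → V → Prop) : Prop := ∀ n m, Q n m → G.IsRoot n ∧ G.IsRoot m

/-! ## Sharing equivalences -/

/-- Sharing equivalences: homogeneous equivalence relations that are closed under the three
downward propagation rules and the scoping rule, and that do not identify two different free
variable nodes. -/
structure IsSharingEquivalence (R : V → V → Prop) : Prop where
  equivalence : Equivalence R
  homogeneous : ∀ n m, R n m → (G.node n).Homogeneous (G.node m)
  left : ∀ n m n₁ n₂ m₁ m₂, R n m →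
    G.node n = Node.app n₁ n₂ → G.node m = Node.app m₁ m₂ → R n₁ m₁
  right : ∀ n m n₁ n₂ m₁ m₂, R n m →
    G.node n = Node.app n₁ n₂ → G.node m = Node.app m₁ m₂ → R n₂ m₂
  down : ∀ n m n₁ m₁, R n m → G.node n = Node.abs n₁ → G.node m = Node.abs m₁ → R n₁ m₁
  scoping : ∀ n m l l', R n m → G.node n = Node.bvar l → G.node m = Node.bvar l' → R l l'
  isOpen : ∀ n m a a', R n m → G.node n = Node.fvar a → G.node m = Node.fvar a' → n = m

/-- The sharing equivalences on `G` that contain `Q`. -/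
def sharingEquivalencesOver (Q : V → V → Prop) : Set (V → V → Prop) :=
  {R | G.IsSharingEquivalence R ∧ ∀ n m, Q n m → R n m}

end PreLambdaDAG

/-! ## The algorithm

The algorithm works on a lambda-DAG that is stored in memory with an array of all its nodes and,
for every node, an array of its parents. It is given as a transition system whose states consist of
a store and an explicit execution stack. A transition executes at most a loop header and one line
or branch of the code, and performs a bounded number of atomic operations: following a pointer,
comparing two nodes, reading or writing one field of one node, advancing in an array or in a linked
list, adding one query edge, pushing to or popping from a queue or the execution stack. -/

/-- How `G` is laid out: a duplicate-free array of all the nodes (in any order), and for every node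
the array of its parents (in any order; a parent may be listed once per edge, or only once). -/
structure Layout {V : Type u} {A : Type v} [DecidableEq V] (G : PreLambdaDAG V A) where
  nodes : List V
  nodes_nodup : nodes.Nodup
  mem_nodes : ∀ n, n ∈ nodes
  parents : V → List V
  mem_parents : ∀ n m, m ∈ parents n ↔ n ∈ (G.node m).children
  count_parents : ∀ n m, (parents n).count m ≤ (G.node m).children.count n

/-- The mutable fields of the nodes. `none` stands for `undefined`. -/
structure Store (V : Type u) where
  /-- The linked list of the neighbours of a node along undirected query edges. -/
  sim : V → List V
  /-- The canonic edge. -/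
  canonic : V → Option V
  /-- The building flag. -/
  building : V → Option Bool
  /-- The queue of the class; queues are empty as long as they are undefined. -/
  queue : V → List V

/-- Activation frames: the line to be executed next, with the local variables. -/
inductive Frame (V : Type u)
  /-- Creation of the initial query edges; `rest` are the pairs still to be read. -/
  | load (rest : List (V × V))
  /-- `BlindCheck`: the loop over all nodes. -/
  | main (rest : List V)
  /-- `BuildClass(c)`: the line `canonic(c) := c`. -/
  | setCanonic (c : V)
  /-- `BuildClass(c)`: the line `building(c) := true`. -/
  | setBuilding (c : V)
  /-- `BuildClass(c)`: the line `queue(c) := {c}`. -/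
  | setQueue (c : V)
  /-- `BuildClass(c)`: the header of the while loop on `queue(c)`. -/
  | loop (c : V)
  /-- `BuildClass(c)`: the loop over the parents of `n`. -/
  | parents (c n : V) (rest : List V)
  /-- `BuildClass(c)`: the loop over the query neighbours of `n`. -/
  | neighbours (c n : V) (rest : List V)
  /-- `BuildClass(c)`: the line `building(c) := false`, and return. -/
  | unsetBuilding (c : V)
  /-- `Enqueue(m, c)`: the case distinction on the two nodes. -/
  | caseSplit (m c : V)
  /-- `Enqueue(m, c)`: the line `canonic(m) := c`. -/
  | setMember (m c : V)
  /-- `Enqueue(m, c)`: the line `queue(c).push(m)`, and return. -/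
  | push (m c : V)
  /-- `VariablesCheck`: the loop over the `Var`-nodes. -/
  | vars (rest : List V)

/-- A state is either `Fail` or a store with an execution stack (the top of which comes first). -/
inductive State (V : Type u)
  | fail
  | run (σ : Store V) (stack : List (Frame V))

namespace Store

variable {V : Type u} [DecidableEq V] (σ : Store V)

/-- Create an undirected query edge between `n` and `m`: push `m` on the list of `n`, and `n` on
the list of `m`. -/
def addEdge (n m : V) : Store V :=
  let sim₁ := Function.update σ.sim n (m :: σ.sim n)
  { σ with sim := Function.update sim₁ m (n :: sim₁ m) }

def putCanonic (n c : V) : Store V :=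
  { σ with canonic := Function.update σ.canonic n (some c) }

def putBuilding (c : V) (b : Bool) : Store V :=
  { σ with building := Function.update σ.building c (some b) }

def putQueue (c : V) (q : List V) : Store V :=
  { σ with queue := Function.update σ.queue c q }

/-- No query edges, and everything undefined. -/
def empty : Store V where
  sim _ := []
  canonic _ := none
  building _ := none
  queue _ := []

end Store

section Machine

variable {V : Type u} {A : Type v} [DecidableEq V] {G : PreLambdaDAG V A} (L : Layout G)

/-- The case distinction of `Enqueue(m, c)` : query edges between corresponding children are
created; `none` if the nodes are not homogeneous. -/
def propagate (G : PreLambdaDAG V A) (σ : Store V) (m c : V) : Option (Store V) :=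
  match G.node m, G.node c with
  | Node.abs m₁, Node.abs c₁ => some (σ.addEdge m₁ c₁)
  | Node.app m₁ m₂, Node.app c₁ c₂ => some ((σ.addEdge m₁ c₁).addEdge m₂ c₂)
  | Node.bvar _, Node.bvar _ => some σ
  | Node.fvar _, Node.fvar _ => some σ
  | _, _ => none

/-- The body of the loop of the variables check, on the `Var`-node `w`: does it pass? -/
def varPasses (G : PreLambdaDAG V A) (σ : Store V) (w : V) : Bool :=
  match σ.canonic w with
  | none => false
  | some w₁ =>
    if w = w₁ then true
    else match (G.node w).binder, (G.node w₁).binder with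
      | some l, some l₁ => decide (σ.canonic l = σ.canonic l₁)
      | _, _ => false

/-- One transition. `Fail` and the states with an empty execution stack have no transitions, which
is rendered by leaving them unchanged. -/
def step : State V → State V
  | .fail => .fail
  | .run σ [] => .run σ []
  | .run σ (.load [] :: k) => .run σ k
  | .run σ (.load ((n, m) :: rest) :: k) => .run (σ.addEdge n m) (.load rest :: k)
  | .run σ (.main [] :: k) => .run σ k
  | .run σ (.main (n :: rest) :: k) =>
    match σ.canonic n with
    | none => .run σ (.setCanonic n :: .main rest :: k)
    | some _ => .run σ (.main rest :: k)
  | .run σ (.setCanonic c :: k) => .run (σ.putCanonic c c) (.setBuilding c :: k)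
  | .run σ (.setBuilding c :: k) => .run (σ.putBuilding c true) (.setQueue c :: k)
  | .run σ (.setQueue c :: k) => .run (σ.putQueue c [c]) (.loop c :: k)
  | .run σ (.loop c :: k) =>
    match σ.queue c with
    | [] => .run σ (.unsetBuilding c :: k)
    | n :: q => .run (σ.putQueue c q) (.parents c n (L.parents n) :: k)
  | .run σ (.parents c n [] :: k) => .run σ (.neighbours c n (σ.sim n) :: k)
  | .run σ (.parents c n (m :: rest) :: k) =>
    match σ.canonic m with
    | none => .run σ (.setCanonic m :: .parents c n rest :: k)
    | some c₁ =>
      if σ.building c₁ = some true then .fail else .run σ (.parents c n rest :: k)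
  | .run σ (.neighbours c _ [] :: k) => .run σ (.loop c :: k)
  | .run σ (.neighbours c n (m :: rest) :: k) =>
    match σ.canonic m with
    | none => .run σ (.caseSplit m c :: .neighbours c n rest :: k)
    | some c₁ => if c₁ = c then .run σ (.neighbours c n rest :: k) else .fail
  | .run σ (.unsetBuilding c :: k) => .run (σ.putBuilding c false) k
  | .run σ (.caseSplit m c :: k) =>
    match propagate G σ m c with
    | none => .fail
    | some σ₁ => .run σ₁ (.setMember m c :: k)
  | .run σ (.setMember m c :: k) => .run (σ.putCanonic m c) (.push m c :: k)
  | .run σ (.push m c :: k) => .run (σ.putQueue c (σ.queue c ++ [m])) k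
  | .run σ (.vars [] :: k) => .run σ k
  | .run σ (.vars (w :: rest) :: k) =>
    if (G.node w).isVar then
      if varPasses G σ w then .run σ (.vars rest :: k) else .fail
    else .run σ (.vars rest :: k)

/-- The initial state of the combined algorithm on the query listed by `qs`: the query edges are
created, then `BlindCheck` is executed, then `VariablesCheck`. -/
def initialState (qs : List (V × V)) : State V :=
  State.run Store.empty [Frame.load qs, Frame.main L.nodes, Frame.vars L.nodes]

/-- The state after `t` transitions (or the last state, if the run is shorter). -/
def stateAfter (qs : List (V × V)) (t : ℕ) : State V := (step L)^[t] (initialState L qs)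

/-- The combined algorithm halts after at most `t` transitions. -/
def HaltsWithin (qs : List (V × V)) (t : ℕ) : Prop :=
  stateAfter L qs t = State.fail ∨ ∃ σ, stateAfter L qs t = State.run σ []

/-- The combined algorithm succeeds, with `c` as its canonic assignment. -/
def Outputs (qs : List (V × V)) (c : V → Option V) : Prop :=
  ∃ t σ, stateAfter L qs t = State.run σ [] ∧ σ.canonic = c

/-- The combined algorithm succeeds. -/
def Succeeds (qs : List (V × V)) : Prop := ∃ c, Outputs L qs c

end Machine

/-- The relation represented by a canonic assignment: both canonics are defined and coincide. -/
def SameCanonic {V : Type u} (c : V → Option V) (n m : V) : Prop :=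
  ∃ r, c n = some r ∧ c m = some r

/-- The canonic edges. -/
def canonicEdges {V : Type u} (c : V → Option V) : Set (V × V) := {e | c e.1 = some e.2}

end SharingEquality

universe u v

open SharingEquality

namespace SharingEquality

/-! ### Homogeneity of nodes -/

namespace Node

variable {V : Type u} {A : Type v}

/-! The blind check is compared with an arbitrary equivalence `E` that contains the query and is
closed under downward propagation between homogeneous nodes. All query edges and canonic edges join
`E`-related nodes, because new edges only link corresponding children of related nodes. A failure of
the blind check shows that `E` is not homogeneous: it exhibits two related inhomogeneous nodes, or a
cycle of the child relation modulo `E`. The latter is excluded for homogeneous `E` by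
`IsLambdaDAG.not_transGen_childMod`: a path in the quotient lifts to a path in the DAG. If the blind
check ends without failure, the canonic fields represent a homogeneous propagated equivalence
containing the query (`Complete`).

The delicate point is that adjacency lists grow during the run. The neighbours of a node are visited
only when all its parents lie in completed classes, whereas an enqueue adds edges only at children
of a node that has no class yet and of a representative still being built. Hence the list of a
visited node is frozen (`Core.sim_enroll_eq`). Its traversal therefore misses nothing, and each list
is paid for once, which makes `Conf.potential` a linear bound on the running time.

Three choices of `E` give the theorem. The total relation gives termination and the correctness of
any output. A sharing equivalence containing the query gives minimality. The equivalence generated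
by `SameTrace` gives success whenever some sharing equivalence `R` contains the query: it is then
contained in `R`, hence homogeneous and propagated. It also respects binders (`SameTrace.binder`):
by domination, the binders of two variables reached by the same trace lie on the two paths, and
acyclicity modulo `R` puts them at the same depth. So the variables check passes. -/

theorem Homogeneous.refl (a : Node V A) : a.Homogeneous a := by
  cases a <;> trivial

theorem Homogeneous.symm {a b : Node V A} (h : a.Homogeneous b) : b.Homogeneous a := by
  cases a <;> cases b <;> trivial

theorem Homogeneous.trans {a b c : Node V A} (h : a.Homogeneous b) (h' : b.Homogeneous c) :
    a.Homogeneous c := by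
  cases a <;> cases b <;> cases c <;> trivial

theorem Homogeneous.length_children {a b : Node V A} (h : a.Homogeneous b) :
    a.children.length = b.children.length := by
  cases a <;> cases b <;> first | rfl | exact h.elim

theorem length_children_le_outDegree (a : Node V A) : a.children.length ≤ a.outDegree := by
  cases a <;> simp [children, outDegree]

end Node

/-! ### Propagated equivalences -/

namespace PreLambdaDAG

variable {V : Type u} {A : Type v} (G : PreLambdaDAG V A)

/-- The pairs of corresponding children of two nodes. -/
def childPairs (n m : V) : List (V × V) := (G.node n).children.zip (G.node m).children

/-- Equivalence relations closed under the downward propagation rules between homogeneous nodes. -/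
structure IsPropagated (E : V → V → Prop) : Prop where
  equivalence : Equivalence E
  down : ∀ n m, E n m → (G.node n).Homogeneous (G.node m) →
    ∀ x ∈ G.childPairs n m, E x.1 x.2

/-- All related nodes are homogeneous. -/
def IsHomogeneous (E : V → V → Prop) : Prop :=
  ∀ n m, E n m → (G.node n).Homogeneous (G.node m)

/-- `n` is a child of `p`. -/
def Child (p n : V) : Prop := n ∈ (G.node p).children

/-- `y` is, up to `E`, a child of `x`. -/
def ChildMod (E : V → V → Prop) (x y : V) : Prop := ∃ x' y', E x x' ∧ E y y' ∧ G.Child x' y'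

variable {G}

theorem childPairs_swap {n m a b : V} (h : (a, b) ∈ G.childPairs n m) :
    (b, a) ∈ G.childPairs m n := by
  unfold childPairs at *
  rw [← List.zip_swap]
  exact List.mem_map.2 ⟨_, h, rfl⟩

theorem fst_eq_snd_of_mem_childPairs {n : V} {x : V × V} (h : x ∈ G.childPairs n n) :
    x.1 = x.2 := by
  unfold childPairs at h
  rw [List.zip_eq_zipWith, List.zipWith_self] at h
  obtain ⟨a, -, rfl⟩ := List.mem_map.1 h
  rfl

/-- Homogeneous nodes have equally many children, so the child of `m` at the same position exists.
This carries propagation through transitivity. -/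
theorem exists_childPairs_between {n m k : V} (h : (G.node n).Homogeneous (G.node m)) {x : V × V}
    (hx : x ∈ G.childPairs n k) : ∃ b, (x.1, b) ∈ G.childPairs n m ∧ (b, x.2) ∈ G.childPairs m k := by
  obtain ⟨i, hi, rfl⟩ := List.mem_iff_getElem.1 hx
  simp only [childPairs, List.length_zip] at hi
  have := h.length_children
  refine ⟨(G.node m).children[i], ?_, ?_⟩ <;>
    exact List.mem_iff_getElem.2 ⟨i, by simp [childPairs]; omega, by simp [childPairs]⟩

theorem exists_childPair {n m a : V} (h : (G.node n).Homogeneous (G.node m)) (ha : G.Child n a) :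
    ∃ b, (a, b) ∈ G.childPairs n m ∧ G.Child m b := by
  obtain ⟨i, hi, rfl⟩ := List.mem_iff_getElem.1 ha
  have hi' : i < (G.node m).children.length := h.length_children ▸ hi
  refine ⟨(G.node m).children[i], ?_, List.getElem_mem _⟩
  refine List.mem_iff_getElem.2 ⟨i, ?_, ?_⟩
  · simp [childPairs]; omega
  · simp [childPairs]

theorem IsSharingEquivalence.isPropagated {R : V → V → Prop} (h : G.IsSharingEquivalence R) :
    G.IsPropagated R where
  equivalence := h.equivalence
  down n m hR _ x hx := by
    have hl := h.left n m
    have hr := h.right n m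
    have hd := h.down n m
    have hh := h.homogeneous n m hR
    unfold childPairs at hx
    cases hn : G.node n <;> cases hm : G.node m <;> rw [hn, hm] at hx hh <;>
      simp only [Node.Homogeneous, Node.children, List.zip_nil_left, List.zip_cons_cons,
        List.mem_cons, List.not_mem_nil, or_false] at hx hh
    · rcases hx with rfl | rfl
      · exact hl _ _ _ _ hR hn hm
      · exact hr _ _ _ _ hR hn hm
    · subst hx; exact hd _ _ hR hn hm

theorem IsPropagated.isSharingEquivalence {R : V → V → Prop} (h : G.IsPropagated R)
    (hh : G.IsHomogeneous R)
    (hs : ∀ n m l l', R n m → G.node n = Node.bvar l → G.node m = Node.bvar l' → R l l')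
    (ho : ∀ n m a a', R n m → G.node n = Node.fvar a → G.node m = Node.fvar a' → n = m) :
    G.IsSharingEquivalence R where
  equivalence := h.equivalence
  homogeneous := hh
  left n m n₁ n₂ m₁ m₂ hR hn hm :=
    h.down n m hR (hh n m hR) (n₁, m₁) (by simp [childPairs, hn, hm, Node.children])
  right n m n₁ n₂ m₁ m₂ hR hn hm :=
    h.down n m hR (hh n m hR) (n₂, m₂) (by simp [childPairs, hn, hm, Node.children])
  down n m n₁ m₁ hR hn hm :=
    h.down n m hR (hh n m hR) (n₁, m₁) (by simp [childPairs, hn, hm, Node.children])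
  scoping := hs
  isOpen := ho

/-! ### Paths -/

/-- The head of a trace is its last direction, so a suffix of the list is an initial segment of the
path. -/
theorem Path.exists_append {r v : V} {σ τ : List Dir} (h : G.Path (σ ++ τ) r v) :
    ∃ x, G.Path τ r x ∧ G.Path σ x v := by
  induction σ generalizing v with
  | nil => exact ⟨v, h, .nil v⟩
  | cons d σ ih =>
    cases h with
    | down h e => obtain ⟨x, h₁, h₂⟩ := ih h; exact ⟨x, h₁, .down h₂ e⟩
    | left h e => obtain ⟨x, h₁, h₂⟩ := ih h; exact ⟨x, h₁, .left h₂ e⟩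
    | right h e => obtain ⟨x, h₁, h₂⟩ := ih h; exact ⟨x, h₁, .right h₂ e⟩

theorem Path.transGen {x y : V} {τ : List Dir} (h : G.Path τ x y) (hτ : τ ≠ []) :
    Relation.TransGen G.Child x y := by
  have key : Relation.ReflTransGen G.Child x y ∧ (τ ≠ [] → Relation.TransGen G.Child x y) := by
    clear hτ
    induction h with
    | nil n => exact ⟨.refl, fun h => (h rfl).elim⟩
    | @down _ n _ b _ e ih =>
      have c : Relation.TransGen G.Child n b := .tail' ih.1 (by simp [Child, e, Node.children])
      exact ⟨c.to_reflTransGen, fun _ => c⟩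
    | @left _ n _ b _ _ e ih =>
      have c : Relation.TransGen G.Child n b := .tail' ih.1 (by simp [Child, e, Node.children])
      exact ⟨c.to_reflTransGen, fun _ => c⟩
    | @right _ n _ _ b _ e ih =>
      have c : Relation.TransGen G.Child n b := .tail' ih.1 (by simp [Child, e, Node.children])
      exact ⟨c.to_reflTransGen, fun _ => c⟩
  exact key.2 hτ

theorem Path.child {r n a : V} {τ : List Dir} (h : G.Path τ r n) (ha : G.Child n a) :
    ∃ d, G.Path (d :: τ) r a := by
  unfold Child at ha
  cases e : G.node n <;> simp only [e, Node.children, List.mem_cons, List.not_mem_nil, or_false] at ha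
  · rcases ha with rfl | rfl
    · exact ⟨_, .left h e⟩
    · exact ⟨_, .right h e⟩
  · subst ha; exact ⟨_, .down h e⟩

theorem Path.childPairs {r r' n m : V} {τ : List Dir} (h : G.Path τ r n) (h' : G.Path τ r' m)
    (hh : (G.node n).Homogeneous (G.node m)) {x : V × V} (hx : x ∈ G.childPairs n m) :
    ∃ d, G.Path (d :: τ) r x.1 ∧ G.Path (d :: τ) r' x.2 := by
  unfold PreLambdaDAG.childPairs at hx
  cases hn : G.node n <;> cases hm : G.node m <;> rw [hn, hm] at hx hh <;>
    simp only [Node.Homogeneous, Node.children, List.zip_nil_left, List.zip_cons_cons,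
      List.mem_cons, List.not_mem_nil, or_false] at hx hh
  · rcases hx with rfl | rfl
    · exact ⟨_, .left h hn, .left h' hm⟩
    · exact ⟨_, .right h hn, .right h' hm⟩
  · subst hx; exact ⟨_, .down h hn, .down h' hm⟩

theorem Crosses.exists_append {r m : V} {τ : List Dir} (h : G.Crosses τ r m) :
    ∃ τ₁, τ₁ <:+ τ ∧ G.Path τ₁ r m := by
  induction h with
  | here h => exact ⟨_, List.suffix_refl _, h⟩
  | step _ _ ih =>
    obtain ⟨τ₁, h₁, h₂⟩ := ih
    exact ⟨τ₁, h₁.trans (List.suffix_cons _ _), h₂⟩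

theorem exists_path_of_transGen {x y : V} (h : Relation.TransGen G.Child x y) :
    ∃ τ, τ ≠ [] ∧ G.Path τ x y := by
  induction h with
  | single h => obtain ⟨d, hd⟩ := (Path.nil (G := G) x).child h; exact ⟨_, by simp, hd⟩
  | tail _ h ih =>
    obtain ⟨τ, -, hp⟩ := ih
    obtain ⟨d, hd⟩ := hp.child h
    exact ⟨_, by simp, hd⟩

theorem IsLambdaDAG.wellFounded (hG : G.IsLambdaDAG) :
    WellFounded (fun y x => Relation.TransGen G.Child x y) := by
  have := hG.finite
  have : IsTrans V (fun y x => Relation.TransGen G.Child x y) := ⟨fun _ _ _ h h' => h'.trans h⟩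
  have : Std.Irrefl (fun y x => Relation.TransGen G.Child x y) := ⟨fun x h => by
    obtain ⟨τ, hτ, hp⟩ := exists_path_of_transGen h
    exact hτ ((hG.acyclic _ _).1 hp)⟩
  exact Finite.wellFounded_of_trans_of_irrefl _

/-! ### Quotients by homogeneous propagated equivalences are acyclic -/

section Quotient

variable {E : V → V → Prop}

theorem ChildMod.congr_left (hE : Equivalence E) {x x' y : V} (hx : E x x') (h : G.ChildMod E x y) :
    G.ChildMod E x' y := by
  obtain ⟨a, b, ha, hb, hc⟩ := h
  exact ⟨a, b, hE.trans (hE.symm hx) ha, hb, hc⟩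

theorem transGen_childMod_congr_left (hE : Equivalence E) {x x' y : V} (hx : E x x')
    (h : Relation.TransGen (G.ChildMod E) x y) : Relation.TransGen (G.ChildMod E) x' y := by
  obtain ⟨b, hb, h⟩ := Relation.TransGen.head'_iff.1 h
  exact .head' (hb.congr_left hE hx) h

/-- Homogeneity allows each step modulo `E` to be replayed from any representative of its source:
the corresponding child exists, and propagation relates it to the original target. -/
theorem exists_transGen_child (hE : G.IsPropagated E) (hh : G.IsHomogeneous E) {x y : V}
    (h : Relation.TransGen (G.ChildMod E) x y) : ∃ y', E y y' ∧ Relation.TransGen G.Child x y' := by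
  have key : ∀ {x z y : V}, E x z → G.ChildMod E x y → ∃ y', E y y' ∧ G.Child z y' := by
    rintro x z y hz ⟨a, b, ha, hb, hc⟩
    have haz : E a z := hE.equivalence.trans (hE.equivalence.symm ha) hz
    obtain ⟨y', hy', hc'⟩ := exists_childPair (hh _ _ haz) hc
    exact ⟨y', hE.equivalence.trans hb (hE.down _ _ haz (hh _ _ haz) _ hy'), hc'⟩
  induction h with
  | single h =>
    obtain ⟨y', h₁, h₂⟩ := key (hE.equivalence.refl _) h
    exact ⟨y', h₁, .single h₂⟩
  | tail _ h ih =>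
    obtain ⟨z, h₁, h₂⟩ := ih
    obtain ⟨y', h₃, h₄⟩ := key h₁ h
    exact ⟨y', h₃, h₂.tail h₄⟩

/-- Infinite descent: a cycle modulo `E` lifts to a non-empty path of the DAG from `x` to an
equivalent node `y'`, and the cycle can be restarted from `y'`, which is strictly below `x`. -/
theorem IsLambdaDAG.not_transGen_childMod (hG : G.IsLambdaDAG) (hE : G.IsPropagated E)
    (hh : G.IsHomogeneous E) {x y : V} (hxy : E x y) :
    ¬ Relation.TransGen (G.ChildMod E) x y := by
  induction x using hG.wellFounded.induction with
  | _ x ih =>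
    intro h
    obtain ⟨y', h₁, h₂⟩ := exists_transGen_child hE hh h
    have e : E x y' := hE.equivalence.trans hxy h₁
    exact ih y' h₂ (hE.equivalence.symm h₁)
      (transGen_childMod_congr_left hE.equivalence e h)

theorem transGen_childMod_of_child (hE : Equivalence E) {x y : V}
    (h : Relation.TransGen G.Child x y) : Relation.TransGen (G.ChildMod E) x y :=
  h.lift id fun a b hab => ⟨a, b, hE.refl a, hE.refl b, hab⟩

end Quotient

/-! ### The spreading of a query -/

variable (G) in
/-- Nodes reached by paths of the same trace from two nodes related by `Q`. -/
def SameTrace (Q : V → V → Prop) (n m : V) : Prop :=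
  ∃ r r' τ, Q r r' ∧ G.Path τ r n ∧ G.Path τ r' m

theorem SameTrace.of_isPropagated {Q E : V → V → Prop} (hE : G.IsPropagated E)
    (hh : G.IsHomogeneous E) (hQ : ∀ n m, Q n m → E n m) {n m : V} (h : G.SameTrace Q n m) :
    E n m := by
  obtain ⟨r, r', τ, hr, h, h'⟩ := h
  induction τ generalizing n m with
  | nil => cases h; cases h'; exact hQ _ _ hr
  | cons d τ ih =>
    cases h with
    | down h e =>
      cases h' with
      | down h' e' =>
        exact hE.down _ _ (ih h h') (hh _ _ (ih h h')) (_, _) (by simp [childPairs, e, e', Node.children])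
    | left h e =>
      cases h' with
      | left h' e' =>
        exact hE.down _ _ (ih h h') (hh _ _ (ih h h')) (n, m) (by simp [childPairs, e, e', Node.children])
    | right h e =>
      cases h' with
      | right h' e' =>
        exact hE.down _ _ (ih h h') (hh _ _ (ih h h')) (n, m) (by simp [childPairs, e, e', Node.children])

variable {Q R : V → V → Prop}

theorem eqvGen_sameTrace_le {E : V → V → Prop} (hE : G.IsPropagated E) (hh : G.IsHomogeneous E)
    (hQ : ∀ n m, Q n m → E n m) {n m : V} (h : Relation.EqvGen (G.SameTrace Q) n m) : E n m := by
  induction h with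
  | rel _ _ h => exact h.of_isPropagated hE hh hQ
  | refl _ => exact hE.equivalence.refl _
  | symm _ _ _ ih => exact hE.equivalence.symm ih
  | trans _ _ _ _ _ ih ih' => exact hE.equivalence.trans ih ih'

theorem isPropagated_eqvGen_sameTrace (hR : G.IsSharingEquivalence R)
    (hQ : ∀ n m, Q n m → R n m) : G.IsPropagated (Relation.EqvGen (G.SameTrace Q)) where
  equivalence := Relation.EqvGen.is_equivalence _
  down n m h _ := by
    have hle : ∀ {n m}, Relation.EqvGen (G.SameTrace Q) n m →
        (G.node n).Homogeneous (G.node m) := fun h =>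
      hR.homogeneous _ _ (eqvGen_sameTrace_le hR.isPropagated hR.homogeneous hQ h)
    induction h with
    | rel n m h =>
      intro x hx
      have hh := hle (.rel _ _ h)
      obtain ⟨r, r', τ, hr, h, h'⟩ := h
      obtain ⟨d, h₁, h₂⟩ := h.childPairs h' hh hx
      exact .rel _ _ ⟨r, r', _, hr, h₁, h₂⟩
    | refl n =>
      intro x hx
      rw [fst_eq_snd_of_mem_childPairs hx]; exact .refl _
    | symm n m _ ih =>
      rename_i h
      rintro ⟨a, b⟩ hx
      exact .symm _ _ (ih h.symm (b, a) (childPairs_swap hx))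
    -- Transitivity needs the intermediate node to be homogeneous to both ends; this is where `R` is
    -- used.
    | trans n m k hnm hmk ih ih' =>
      intro x hx
      obtain ⟨b, h₁, h₂⟩ := exists_childPairs_between (hle hnm) hx
      exact .trans _ b _ (ih (hle hnm) _ h₁) (ih' (hle hmk) _ h₂)

/-- If `τ` were a proper suffix of `τ'`, the path to `l'` would pass, after `τ`, through a node `x`
with `R l x`. Then `x` is `R`-related to its proper descendant `l'`, a cycle modulo `R`. -/
theorem binder_comparison (hG : G.IsLambdaDAG) (hR : G.IsSharingEquivalence R)
    (hQ : ∀ n m, Q n m → R n m) {l l' r r' : V} {τ τ' : List Dir} (hr : Q r r') (hl : R l l')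
    (h : G.Path τ r l) (h' : G.Path τ' r' l') (hs : τ <:+ τ') : τ = τ' := by
  obtain ⟨e, rfl⟩ := hs
  by_contra hne
  have he : e ≠ [] := by rintro rfl; exact hne rfl
  obtain ⟨x, h₁, h₂⟩ := h'.exists_append
  have hx : R l x := SameTrace.of_isPropagated hR.isPropagated hR.homogeneous hQ
    ⟨r, r', τ, hr, h, h₁⟩
  exact hG.not_transGen_childMod hR.isPropagated hR.homogeneous
    (hR.equivalence.trans (hR.equivalence.symm hx) hl)
    (transGen_childMod_of_child hR.equivalence (h₂.transGen he))

/-- Query nodes are roots, so domination places both binders on the two paths, at suffixes of the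
same trace. Two such suffixes are comparable, and `binder_comparison`, applied to `Q` or to its
converse, makes them equal. -/
theorem SameTrace.binder (hG : G.IsLambdaDAG) (hq : G.IsQuery Q) (hR : G.IsSharingEquivalence R)
    (hQ : ∀ n m, Q n m → R n m) {v w l l' : V} (h : G.SameTrace Q v w)
    (hv : G.node v = .bvar l) (hw : G.node w = .bvar l') : G.SameTrace Q l l' := by
  have hl : R l l' := hR.scoping v w l l'
    (h.of_isPropagated hR.isPropagated hR.homogeneous hQ) hv hw
  obtain ⟨r, r', τ, hr, h, h'⟩ := h
  obtain ⟨τ₁, hs₁, h₁⟩ := (hG.dominated v l hv r τ (hq _ _ hr).1 h).exists_append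
  obtain ⟨τ₂, hs₂, h₂⟩ := (hG.dominated w l' hw r' τ (hq _ _ hr).2 h').exists_append
  have e : τ₁ = τ₂ := by
    rcases List.suffix_or_suffix_of_suffix hs₁ hs₂ with hs | hs
    · exact binder_comparison hG hR hQ hr hl h₁ h₂ hs
    · have hq' : ∀ n m, Q m n → R n m := fun n m h => hR.equivalence.symm (hQ _ _ h)
      exact (binder_comparison (Q := fun n m => Q m n) hG hR hq' hr (hR.equivalence.symm hl)
        h₂ h₁ hs).symm
  subst e
  exact ⟨r, r', τ₁, hr, h₁, h₂⟩

/-- The spreading of a query on roots is closed under the scoping rule, as soon as there is some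
sharing equivalence that contains the query. -/
theorem eqvGen_sameTrace_binder (hG : G.IsLambdaDAG) (hq : G.IsQuery Q)
    (hR : G.IsSharingEquivalence R) (hQ : ∀ n m, Q n m → R n m) {v w l l' : V}
    (h : Relation.EqvGen (G.SameTrace Q) v w)
    (hv : G.node v = .bvar l) (hw : G.node w = .bvar l') :
    Relation.EqvGen (G.SameTrace Q) l l' := by
  induction h generalizing l l' with
  | rel _ _ h => exact .rel _ _ (h.binder hG hq hR hQ hv hw)
  | refl _ => rw [hv] at hw; cases hw; exact .refl _
  | symm _ _ _ ih => exact .symm _ _ (ih hw hv)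
  -- The intermediate node is homogeneous to a bound variable, hence has a binder to which both
  -- induction hypotheses apply.
  | trans a b c h _ ih ih' =>
    have hh := hR.homogeneous _ _ (eqvGen_sameTrace_le hR.isPropagated hR.homogeneous hQ h)
    rw [hv] at hh
    cases hb : G.node b with
    | bvar k => exact .trans _ _ _ (ih hv hb) (ih' hb hw)
    | app _ _ => rw [hb] at hh; exact hh.elim
    | abs _ => rw [hb] at hh; exact hh.elim
    | fvar _ => rw [hb] at hh; exact hh.elim

end PreLambdaDAG

end SharingEquality

namespace SharingEquality

open PreLambdaDAG

variable {V : Type u} {A : Type v} [DecidableEq V] {G : PreLambdaDAG V A}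

/-! ### Operations on the store -/

namespace Store

/-- The class of `p` is completely built. -/
def Done (σ : Store V) (p : V) : Prop := ∃ c, σ.canonic p = some c ∧ σ.building c = some false

/-- Canonic edges and completed classes of `σ` persist in `σ'`. -/
structure Extends (σ σ' : Store V) : Prop where
  canonic : ∀ n c, σ.canonic n = some c → σ'.canonic n = some c
  done : ∀ p, σ.Done p → σ'.Done p

/-- The store after the first three lines of `BuildClass(m)`. -/
def enter (σ : Store V) (m : V) : Store V :=
  ((σ.putCanonic m m).putBuilding m true).putQueue m [m]

/-- The store after the last two lines of `Enqueue(m, c)`. -/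
def enroll (σ : Store V) (m c : V) : Store V :=
  (σ.putCanonic m c).putQueue c (σ.queue c ++ [m])

theorem mem_sim_addEdge (σ : Store V) (n m a b : V) :
    b ∈ (σ.addEdge n m).sim a ↔ b ∈ σ.sim a ∨ (a = n ∧ b = m) ∨ (a = m ∧ b = n) := by
  simp only [addEdge, Function.update_apply]
  by_cases h₁ : a = m <;> by_cases h₂ : a = n <;> by_cases h₃ : m = n <;> simp_all <;> tauto

theorem length_sim_addEdge_le (σ : Store V) (n m a : V) :
    ((σ.addEdge n m).sim a).length ≤
      (σ.sim a).length + ((if a = n then 1 else 0) + (if a = m then 1 else 0)) := by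
  simp only [addEdge, Function.update_apply]
  by_cases h₁ : a = m <;> by_cases h₂ : a = n <;> by_cases h₃ : m = n <;> simp_all

theorem sum_length_sim_addEdge_le (σ : Store V) (n m : V) (S : Finset V) :
    ∑ a ∈ S, ((σ.addEdge n m).sim a).length ≤ ∑ a ∈ S, (σ.sim a).length + 2 := by
  have hone : ∀ k : V, ∑ a ∈ S, (if a = k then 1 else 0) ≤ 1 := fun k => by
    rw [Finset.sum_ite_eq']; split_ifs <;> simp
  calc ∑ a ∈ S, ((σ.addEdge n m).sim a).length
      ≤ ∑ a ∈ S, ((σ.sim a).length + ((if a = n then 1 else 0) + (if a = m then 1 else 0))) :=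
        Finset.sum_le_sum fun a _ => length_sim_addEdge_le σ n m a
    _ = ∑ a ∈ S, (σ.sim a).length +
        (∑ a ∈ S, (if a = n then 1 else 0) + ∑ a ∈ S, (if a = m then 1 else 0)) := by
        rw [Finset.sum_add_distrib, Finset.sum_add_distrib]
    _ ≤ ∑ a ∈ S, (σ.sim a).length + 2 := by
        have := hone n; have := hone m; omega

theorem sim_addEdge_of_ne (σ : Store V) {n m a : V} (h₁ : a ≠ n) (h₂ : a ≠ m) :
    (σ.addEdge n m).sim a = σ.sim a := by
  simp [addEdge, Function.update_apply, h₁, h₂]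

end Store

/-- The effect of the case distinction of `Enqueue(m, c)`. -/
structure Propagates (G : PreLambdaDAG V A) (σ : Store V) (m c : V) (σ' : Store V) : Prop where
  homogeneous : (G.node m).Homogeneous (G.node c)
  canonic : σ'.canonic = σ.canonic
  building : σ'.building = σ.building
  queue : σ'.queue = σ.queue
  mem_sim : ∀ a b, b ∈ σ'.sim a ↔
    b ∈ σ.sim a ∨ (a, b) ∈ G.childPairs m c ∨ (b, a) ∈ G.childPairs m c
  sim_eq : ∀ a, ¬ G.Child m a → ¬ G.Child c a → σ'.sim a = σ.sim a
  sum_le : ∀ S : Finset V, ∑ a ∈ S, (σ'.sim a).length ≤ ∑ a ∈ S, (σ.sim a).length + 4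

theorem propagates_of_propagate_eq_some {σ σ' : Store V} {m c : V}
    (h : propagate G σ m c = some σ') : Propagates G σ m c σ' := by
  unfold propagate at h
  split at h <;> simp only [Option.some.injEq, reduceCtorEq] at h <;> subst h
  · rename_i hm hc
    refine ⟨by simp [hm, hc, Node.Homogeneous], rfl, rfl, rfl, ?_, ?_, ?_⟩
    · intro a b
      simp [Store.mem_sim_addEdge, childPairs, hm, hc, Node.children]
      tauto
    · intro a h₁ h₂
      simp only [Child, hm, hc, Node.children, List.mem_singleton] at h₁ h₂
      exact σ.sim_addEdge_of_ne h₁ h₂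
    · intro S
      exact (σ.sum_length_sim_addEdge_le _ _ S).trans (by omega)
  · rename_i m₁ m₂ c₁ c₂ hm hc
    refine ⟨by simp [hm, hc, Node.Homogeneous], rfl, rfl, rfl, ?_, ?_, ?_⟩
    · intro a b
      simp [Store.mem_sim_addEdge, childPairs, hm, hc, Node.children]
      tauto
    · intro a h₁ h₂
      simp only [Child, hm, hc, Node.children, List.mem_cons, List.not_mem_nil, or_false,
        not_or] at h₁ h₂
      rw [Store.sim_addEdge_of_ne _ h₁.2 h₂.2, Store.sim_addEdge_of_ne _ h₁.1 h₂.1]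
    · intro S
      exact ((σ.addEdge m₁ c₁).sum_length_sim_addEdge_le m₂ c₂ S).trans
        (Nat.add_le_add_right (σ.sum_length_sim_addEdge_le m₁ c₁ S) 2)
  · rename_i hm hc
    exact ⟨by simp [hm, hc, Node.Homogeneous], rfl, rfl, rfl,
      by simp [childPairs, hm, Node.children], fun _ _ _ => rfl, fun _ => by omega⟩
  · rename_i hm hc
    exact ⟨by simp [hm, hc, Node.Homogeneous], rfl, rfl, rfl,
      by simp [childPairs, hm, Node.children], fun _ _ _ => rfl, fun _ => by omega⟩

theorem not_homogeneous_of_propagate_eq_none {σ : Store V} {m c : V}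
    (h : propagate G σ m c = none) : ¬ (G.node m).Homogeneous (G.node c) := by
  unfold propagate at h
  cases hm : G.node m <;> cases hc : G.node c <;> simp_all [Node.Homogeneous]

/-! ### The invariant of the store -/

/-- The invariant of the store during the blind check. `P` are the nodes whose parents have been
visited, `D` those that have been popped, `act` the representatives of the classes that are being
built, and `ex` the node whose neighbours are being visited, if any. -/
structure Core (G : PreLambdaDAG V A) (qs : List (V × V)) (E : V → V → Prop) (σ : Store V)
    (P D : Finset V) (act : List V) (ex : Option V) : Prop where
  canonic : ∀ n c, σ.canonic n = some c → σ.canonic c = some c ∧ E n c ∧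
    (G.node n).Homogeneous (G.node c) ∧ (n = c ∨ ∀ x ∈ G.childPairs n c, x.2 ∈ σ.sim x.1)
  sim_symm : ∀ n m, m ∈ σ.sim n → n ∈ σ.sim m
  sim_rel : ∀ n m, m ∈ σ.sim n → E n m
  query : ∀ n m, (n, m) ∈ qs → m ∈ σ.sim n
  subset : P ⊆ D
  popped : ∀ n ∈ D, ∃ c, σ.canonic n = some c
  parents_done : ∀ n ∈ P, ∀ p, G.Child p n → σ.Done p
  sim_done : ∀ n ∈ P, ex ≠ some n → ∀ m ∈ σ.sim n, σ.canonic m = σ.canonic n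
  status : ∀ n c, σ.canonic n = some c →
    (σ.building c = some true ∧ c ∈ act ∧ (n ∈ D ∨ n ∈ σ.queue c)) ∨
    (σ.building c = some false ∧ n ∈ P)
  active : ∀ c ∈ act, σ.building c = some true ∧ σ.canonic c = some c
  active_nodup : act.Nodup
  queue : ∀ c, ∀ n ∈ σ.queue c, σ.canonic n = some c ∧ n ∉ D
  queue_nodup : ∀ c, (σ.queue c).Nodup

namespace Core

variable {qs : List (V × V)} {E : V → V → Prop} {σ : Store V} {P D : Finset V} {act : List V}
  {ex : Option V}

theorem extends_enter (h : Core G qs E σ P D act ex) {m : V} (hm : σ.canonic m = none) :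
    σ.Extends (σ.enter m) where
  canonic n c hn := by
    have : n ≠ m := by rintro rfl; simp [hm] at hn
    simp [Store.enter, Store.putQueue, Store.putBuilding, Store.putCanonic, this, hn]
  done := by
    rintro p ⟨c, h₁, h₂⟩
    have hp : p ≠ m := by rintro rfl; simp [hm] at h₁
    have hc : c ≠ m := by rintro rfl; simpa [hm] using (h.canonic _ _ h₁).1
    exact ⟨c, by simp [Store.enter, Store.putQueue, Store.putBuilding, Store.putCanonic, hp, h₁],
      by simp [Store.enter, Store.putQueue, Store.putBuilding, Store.putCanonic, hc, h₂]⟩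

theorem enter (hE : Equivalence E) (h : Core G qs E σ P D act none) {m : V}
    (hm : σ.canonic m = none) : Core G qs E (σ.enter m) P D (m :: act) none := by
  have hx := h.extends_enter hm
  have hne : ∀ {n c}, σ.canonic n = some c → n ≠ m := by
    rintro n c hn rfl; simp [hm] at hn
  have hcm : (σ.enter m).canonic m = some m := by
    simp [Store.enter, Store.putQueue, Store.putBuilding, Store.putCanonic]
  have hco : ∀ n, n ≠ m → (σ.enter m).canonic n = σ.canonic n := by
    intro n hn; simp [Store.enter, Store.putQueue, Store.putBuilding, Store.putCanonic, hn]
  have hbo : ∀ n, n ≠ m → (σ.enter m).building n = σ.building n := by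
    intro n hn; simp [Store.enter, Store.putQueue, Store.putBuilding, Store.putCanonic, hn]
  have hbm : (σ.enter m).building m = some true := by
    simp [Store.enter, Store.putQueue, Store.putBuilding]
  have hqo : ∀ n, n ≠ m → (σ.enter m).queue n = σ.queue n := by
    intro n hn; simp [Store.enter, Store.putQueue, Store.putBuilding, Store.putCanonic, hn]
  have hqm : (σ.enter m).queue m = [m] := by simp [Store.enter, Store.putQueue]
  have hmD : m ∉ D := fun hD => by obtain ⟨c, hc⟩ := h.popped m hD; exact hne hc rfl
  refine ⟨?_, h.sim_symm, h.sim_rel, h.query, h.subset, ?_, ?_, ?_, ?_, ?_, ?_, ?_, ?_⟩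
  · intro n c hn
    by_cases hnm : n = m
    · subst hnm
      rw [hcm] at hn; cases hn
      exact ⟨hcm, hE.refl _, .refl _, .inl rfl⟩
    · rw [hco n hnm] at hn
      obtain ⟨h₁, h₂⟩ := h.canonic n c hn
      exact ⟨hx.canonic _ _ h₁, h₂⟩
  · intro n hn
    obtain ⟨c, hc⟩ := h.popped n hn
    exact ⟨c, hx.canonic _ _ hc⟩
  · exact fun n hn p hp => hx.done _ (h.parents_done n hn p hp)
  · intro n hn hex k hk
    obtain ⟨c, hc⟩ := h.popped n (h.subset hn)
    have hk' := h.sim_done n hn hex k hk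
    rw [hx.canonic n c hc, hx.canonic k c (hk'.trans hc)]
  · intro n c hn
    by_cases hnm : n = m
    · subst hnm
      rw [hcm] at hn; cases hn
      exact .inl ⟨hbm, by simp, .inr (by simp [hqm])⟩
    · rw [hco n hnm] at hn
      have hc : c ≠ m := hne (h.canonic n c hn).1
      rw [hbo c hc, hqo c hc]
      exact (h.status n c hn).imp_left fun ⟨a, b, d⟩ => ⟨a, by simp [b], d⟩
  · intro c hc
    rcases List.mem_cons.1 hc with rfl | hc
    · exact ⟨hbm, hcm⟩
    · have := h.active c hc
      exact ⟨by rw [hbo c (hne this.2)]; exact this.1, hx.canonic _ _ this.2⟩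
  · exact List.nodup_cons.2 ⟨fun hc => hne (h.active m hc).2 rfl, h.active_nodup⟩
  · intro c n hn
    by_cases hc : c = m
    · subst hc
      rw [hqm, List.mem_singleton] at hn
      subst hn
      exact ⟨hcm, hmD⟩
    · rw [hqo c hc] at hn
      exact ⟨hx.canonic _ _ (h.queue c n hn).1, (h.queue c n hn).2⟩
  · intro c
    by_cases hc : c = m
    · subst hc; simp [hqm]
    · rw [hqo c hc]; exact h.queue_nodup c

theorem pop (h : Core G qs E σ P D act ex) {c n : V} {q : List V} (hq : σ.queue c = n :: q) :
    Core G qs E (σ.putQueue c q) P (insert n D) act ex := by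
  have hn : n ∈ σ.queue c := by simp [hq]
  have hnd := h.queue_nodup c
  rw [hq, List.nodup_cons] at hnd
  refine ⟨h.canonic, h.sim_symm, h.sim_rel, h.query, h.subset.trans (Finset.subset_insert _ _),
    ?_, h.parents_done, h.sim_done, ?_, h.active, h.active_nodup, ?_, ?_⟩
  · intro k hk
    rcases Finset.mem_insert.1 hk with rfl | hk
    · exact ⟨c, (h.queue c k hn).1⟩
    · exact h.popped k hk
  · intro k d hk
    refine (h.status k d hk).imp_left fun ⟨h₁, h₂, h₃⟩ => ⟨h₁, h₂, ?_⟩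
    rcases h₃ with h₃ | h₃
    · exact .inl (Finset.mem_insert_of_mem h₃)
    · by_cases hd : d = c
      · subst hd
        rw [hq] at h₃
        rcases List.mem_cons.1 h₃ with rfl | h₃
        · exact .inl (Finset.mem_insert_self _ _)
        · exact .inr (by simpa [Store.putQueue] using h₃)
      · exact .inr (by simpa [Store.putQueue, hd] using h₃)
  · intro d k hk
    have hk' : k ∈ σ.queue d ∧ k ≠ n := by
      by_cases hd : d = c
      · subst hd
        simp only [Store.putQueue, Function.update_self] at hk
        exact ⟨by simp [hq, hk], by rintro rfl; exact hnd.1 hk⟩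
      · simp only [Store.putQueue, Function.update_of_ne hd] at hk
        refine ⟨hk, ?_⟩
        rintro rfl
        have h₁ := (h.queue c k hn).1
        rw [(h.queue d k hk).1] at h₁
        exact hd (Option.some.inj h₁)
    refine ⟨(h.queue d k hk'.1).1, ?_⟩
    rw [Finset.mem_insert, not_or]
    exact ⟨hk'.2, (h.queue d k hk'.1).2⟩
  · intro d
    by_cases hd : d = c
    · subst hd; simpa [Store.putQueue] using hnd.2
    · simpa [Store.putQueue, hd] using h.queue_nodup d

theorem extends_pop (σ : Store V) (c : V) (q : List V) : σ.Extends (σ.putQueue c q) :=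
  ⟨fun _ _ h => h, fun _ h => h⟩

/-- From here on `n` counts as visited; the exception `some n` suspends `sim_done` for it until its
neighbour loop ends. -/
theorem visit (h : Core G qs E σ P D act none) {n : V} (hn : n ∈ D)
    (hp : ∀ p, G.Child p n → σ.Done p) : Core G qs E σ (insert n P) D act (some n) := by
  refine ⟨h.canonic, h.sim_symm, h.sim_rel, h.query, Finset.insert_subset hn h.subset, h.popped,
    ?_, ?_, ?_, h.active, h.active_nodup, h.queue, h.queue_nodup⟩
  · intro k hk
    rcases Finset.mem_insert.1 hk with rfl | hk
    · exact hp
    · exact h.parents_done k hk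
  · intro k hk hne
    rcases Finset.mem_insert.1 hk with rfl | hk
    · exact (hne rfl).elim
    · exact h.sim_done k hk (by simp)
  · exact fun k c hk => (h.status k c hk).imp_right fun ⟨a, b⟩ => ⟨a, Finset.mem_insert_of_mem b⟩

theorem leave {n : V} (h : Core G qs E σ P D act (some n))
    (hn : ∀ m ∈ σ.sim n, σ.canonic m = σ.canonic n) : Core G qs E σ P D act none :=
  { h with
    sim_done := fun k hk _ => by
      by_cases hkn : n = k
      · subst hkn; exact hn
      · exact h.sim_done k hk (by simpa using hkn) }

theorem extends_finish (σ : Store V) (c : V) : σ.Extends (σ.putBuilding c false) := by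
  refine ⟨fun _ _ h => h, ?_⟩
  rintro p ⟨d, h₁, h₂⟩
  refine ⟨d, h₁, ?_⟩
  simp only [Store.putBuilding, Function.update_apply]
  split_ifs
  · rfl
  · exact h₂

theorem finish {c : V} (h : Core G qs E σ P D (c :: act) ex)
    (hc : ∀ n, σ.canonic n = some c → n ∈ P) : Core G qs E (σ.putBuilding c false) P D act ex := by
  have hnd := List.nodup_cons.1 h.active_nodup
  have hx := extends_finish σ c
  refine ⟨h.canonic, h.sim_symm, h.sim_rel, h.query, h.subset, h.popped,
    fun n hn p hp => hx.done _ (h.parents_done n hn p hp), h.sim_done, ?_, ?_, hnd.2, h.queue,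
    h.queue_nodup⟩
  · intro n d hn
    by_cases hd : d = c
    · subst hd
      exact .inr ⟨by simp [Store.putBuilding], hc n hn⟩
    · simp only [Store.putBuilding, Function.update_of_ne hd]
      refine (h.status n d hn).imp_left fun ⟨h₁, h₂, h₃⟩ => ⟨h₁, ?_, h₃⟩
      exact (List.mem_cons.1 h₂).resolve_left hd
  · intro d hd
    have hne : d ≠ c := by rintro rfl; exact hnd.1 hd
    have := h.active d (List.mem_cons_of_mem _ hd)
    simpa [Store.putBuilding, hne] using this

/-! ### Adding a node to a class -/

section Enroll

variable {σ' : Store V} {m c : V}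

theorem extends_enroll (hm : σ.canonic m = none) (hp : Propagates G σ m c σ') :
    σ.Extends (σ'.enroll m c) := by
  have hne : ∀ {n d}, σ.canonic n = some d → n ≠ m := by
    rintro n d hn rfl; simp [hm] at hn
  refine ⟨fun n d hn => ?_, ?_⟩
  · simpa [Store.enroll, Store.putQueue, Store.putCanonic, hp.canonic, hne hn] using hn
  · rintro p ⟨d, h₁, h₂⟩
    exact ⟨d, by simpa [Store.enroll, Store.putQueue, Store.putCanonic, hp.canonic, hne h₁] using h₁,
      by simpa [Store.enroll, Store.putQueue, Store.putCanonic, hp.building] using h₂⟩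

/-- New edges touch only children of `m` and of `c`. All parents of a visited node are in completed
classes, but `m` has no class and the class of `c` is being built, so neither is such a parent. -/
theorem sim_enroll_eq (h : Core G qs E σ P D act ex) (hm : σ.canonic m = none)
    (hp : Propagates G σ m c σ') (hc : c ∈ act) {n : V} (hn : n ∈ P) :
    (σ'.enroll m c).sim n = σ.sim n := by
  refine hp.sim_eq n (fun hch => ?_) (fun hch => ?_)
  · obtain ⟨d, hd, -⟩ := h.parents_done n hn m hch
    simp [hm] at hd
  · obtain ⟨d, hd, hb⟩ := h.parents_done n hn c hch
    have := h.active c hc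
    rw [this.2] at hd; cases hd
    simp [this.1] at hb

theorem enroll (hE : G.IsPropagated E) (h : Core G qs E σ P D act ex) (hm : σ.canonic m = none)
    (hp : Propagates G σ m c σ') (hc : c ∈ act) (hmc : E m c) :
    Core G qs E (σ'.enroll m c) P D act ex := by
  have hx := extends_enroll hm hp
  have hne : ∀ {n d}, σ.canonic n = some d → n ≠ m := by
    rintro n d hn rfl; simp [hm] at hn
  have hcm : (σ'.enroll m c).canonic m = some c := by
    simp [Store.enroll, Store.putQueue, Store.putCanonic]
  have hco : ∀ n, n ≠ m → (σ'.enroll m c).canonic n = σ.canonic n := by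
    intro n hn; simp [Store.enroll, Store.putQueue, Store.putCanonic, hn, hp.canonic]
  have hb : (σ'.enroll m c).building = σ.building := hp.building
  have hqc : (σ'.enroll m c).queue c = σ.queue c ++ [m] := by
    simp [Store.enroll, Store.putQueue, hp.queue]
  have hqo : ∀ n, n ≠ c → (σ'.enroll m c).queue n = σ.queue n := by
    intro n hn; simp [Store.enroll, Store.putQueue, Store.putCanonic, hn, hp.queue]
  have hs : ∀ a b, b ∈ (σ'.enroll m c).sim a ↔
    b ∈ σ.sim a ∨ (a, b) ∈ G.childPairs m c ∨ (b, a) ∈ G.childPairs m c := hp.mem_sim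
  have hmD : m ∉ D := fun hD => by obtain ⟨d, hd⟩ := h.popped m hD; exact hne hd rfl
  have hcc := (h.active c hc).2
  refine ⟨?_, ?_, ?_, ?_, h.subset, ?_, ?_, ?_, ?_, ?_, h.active_nodup, ?_, ?_⟩
  · intro n d hn
    by_cases hnm : n = m
    · subst hnm
      rw [hcm] at hn; cases hn
      exact ⟨hx.canonic _ _ hcc, hmc, hp.homogeneous,
        .inr fun x hx => (hs _ _).2 (.inr (.inl hx))⟩
    · rw [hco n hnm] at hn
      obtain ⟨h₁, h₂, h₃, h₄⟩ := h.canonic n d hn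
      exact ⟨hx.canonic _ _ h₁, h₂, h₃, h₄.imp_right fun h₄ x hx => (hs _ _).2 (.inl (h₄ x hx))⟩
  · intro a b hab
    rw [hs] at hab ⊢
    have := h.sim_symm a b
    tauto
  · intro a b hab
    rcases (hs a b).1 hab with hab | hab | hab
    · exact h.sim_rel a b hab
    · exact hE.down m c hmc hp.homogeneous _ hab
    · exact hE.equivalence.symm (hE.down m c hmc hp.homogeneous _ hab)
  · exact fun a b hab => (hs a b).2 (.inl (h.query a b hab))
  · intro n hn
    obtain ⟨d, hd⟩ := h.popped n hn
    exact ⟨d, hx.canonic _ _ hd⟩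
  · exact fun n hn p hp => hx.done _ (h.parents_done n hn p hp)
  · intro n hn hex k hk
    rw [h.sim_enroll_eq hm hp hc hn] at hk
    obtain ⟨d, hd⟩ := h.popped n (h.subset hn)
    have hk' := h.sim_done n hn hex k hk
    rw [hx.canonic n d hd, hx.canonic k d (hk'.trans hd)]
  · intro n d hn
    rw [hb]
    by_cases hnm : n = m
    · subst hnm
      rw [hcm] at hn; cases hn
      exact .inl ⟨(h.active _ hc).1, hc, .inr (by simp [hqc])⟩
    · rw [hco n hnm] at hn
      refine (h.status n d hn).imp_left fun ⟨h₁, h₂, h₃⟩ => ⟨h₁, h₂, h₃.imp_right fun h₃ => ?_⟩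
      by_cases hd : d = c
      · subst hd; rw [hqc]; simp [h₃]
      · rwa [hqo d hd]
  · intro d hd
    rw [hb]
    exact ⟨(h.active d hd).1, hx.canonic _ _ (h.active d hd).2⟩
  · intro d n hn
    by_cases hd : d = c
    · subst hd
      rw [hqc, List.mem_append, List.mem_singleton] at hn
      rcases hn with hn | rfl
      · exact ⟨hx.canonic _ _ (h.queue d n hn).1, (h.queue d n hn).2⟩
      · exact ⟨hcm, hmD⟩
    · rw [hqo d hd] at hn
      exact ⟨hx.canonic _ _ (h.queue d n hn).1, (h.queue d n hn).2⟩
  · intro d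
    by_cases hd : d = c
    · subst hd
      rw [hqc]
      refine List.nodup_append.2 ⟨h.queue_nodup d, by simp, ?_⟩
      rintro a ha b hb rfl
      rw [List.mem_singleton] at hb
      exact hne (h.queue d a ha).1 hb
    · rw [hqo d hd]; exact h.queue_nodup d

end Enroll

end Core

end SharingEquality

namespace SharingEquality

open PreLambdaDAG

variable {V : Type u} {A : Type v} {G : PreLambdaDAG V A}

/-! ### The execution stack -/

/-- What is executed above the suspended loops over parents. -/
inductive Top (V : Type u)
  | resume
  | loop (c : V)
  | neighbours (c n : V) (rest : List V)

/-- A state of the blind check, between two loop iterations. An entry `(c, n, r)` of `waiting`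
is a loop of `BuildClass(c)` over the parents of `n`, with `r` still to be visited; `rest` are the
nodes that remain for the main loop. The sets `visited` and `popped` are ghost variables. -/
structure Conf (V : Type u) where
  store : Store V
  waiting : List (V × V × List V)
  rest : List V
  top : Top V
  visited : Finset V
  popped : Finset V

/-- The part of the stack that consists of suspended loops. -/
def suspended [DecidableEq V] (L : Layout G) (W : List (V × V × List V)) (rest : List V) : List (Frame V) :=
  W.map (fun w => .parents w.1 w.2.1 w.2.2) ++ [.main rest, .vars L.nodes]

/-- The suspended loops over parents are consistent with the store; `top` is the class on which the
first of them waits, if any. -/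
def Waits (G : PreLambdaDAG V A) (σ : Store V) (P D : Finset V) :
    Option V → List (V × V × List V) → Prop
  | _, [] => True
  | top, (c, n, r) :: W =>
    σ.canonic n = some c ∧ n ∈ D ∧ n ∉ P ∧ (∀ p ∈ r, G.Child p n) ∧
    (∀ p, G.Child p n → p ∈ r ∨ σ.Done p ∨ top = some p) ∧
    (∀ t, top = some t → G.Child t n) ∧ Waits G σ P D (some c) W

namespace Waits

variable {σ σ' : Store V} {P P' D D' : Finset V} {top : Option V} {W : List (V × V × List V)}

theorem canonic (h : Waits G σ P D top W) : ∀ w ∈ W, σ.canonic w.2.1 = some w.1 := by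
  induction W generalizing top with
  | nil => simp
  | cons w W ih =>
    obtain ⟨h₁, -, -, -, -, -, h₂⟩ := h
    intro w' hw'
    rcases List.mem_cons.1 hw' with rfl | hw'
    · exact h₁
    · exact ih h₂ w' hw'

theorem mono (h : Waits G σ P D top W) (hx : σ.Extends σ') (hD : D ⊆ D')
    (hP : ∀ w ∈ W, w.2.1 ∉ P → w.2.1 ∉ P') : Waits G σ' P' D' top W := by
  induction W generalizing top with
  | nil => trivial
  | cons w W ih =>
    obtain ⟨h₁, h₂, h₃, h₄, h₅, h₆, h₇⟩ := h
    exact ⟨hx.canonic _ _ h₁, hD h₂, hP w (by simp) h₃, h₄,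
      fun p hp => (h₅ p hp).imp_right (.imp_left (hx.done p)), h₆,
      ih h₇ fun w hw => hP w (List.mem_cons_of_mem _ hw)⟩

/-- The parent on which the first loop was waiting is `c` itself, so completing its class discharges
that entry. -/
theorem resume {c : V} (h : Waits G σ P D (some c) W) (hc : σ.Done c) : Waits G σ P D none W := by
  cases W with
  | nil => trivial
  | cons w W =>
    obtain ⟨h₁, h₂, h₃, h₄, h₅, -, h₇⟩ := h
    refine ⟨h₁, h₂, h₃, h₄, fun p hp => ?_, by simp, h₇⟩
    rcases h₅ p hp with hp | hp | hp
    · exact .inl hp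
    · exact .inr (.inl hp)
    · cases hp; exact .inr (.inl hc)

/-- A nested call is made on a parent of a node of the waiting class. Each class on the stack is
therefore, modulo `E`, a parent of the class that waits for it, and these steps compose. -/
theorem transGen {E : V → V → Prop} (hE : Equivalence E)
    (hσ : ∀ n c, σ.canonic n = some c → E n c) {t : V} (h : Waits G σ P D (some t) W) :
    ∀ c ∈ W.map Prod.fst, Relation.TransGen (G.ChildMod E) t c := by
  induction W generalizing t with
  | nil => simp
  | cons w W ih =>
    obtain ⟨h₁, -, -, -, -, h₆, h₇⟩ := h
    have hs : G.ChildMod E t w.1 := ⟨t, w.2.1, hE.refl _, hE.symm (hσ _ _ h₁), h₆ t rfl⟩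
    intro c hc
    rcases List.mem_cons.1 hc with rfl | hc
    · exact .single hs
    · exact .head hs (ih h₇ c hc)

end Waits

/-! ### Configurations of the blind check -/

namespace Conf

def frames [DecidableEq V] (L : Layout G) (x : Conf V) : List (Frame V) :=
  match x.top with
  | .resume => suspended L x.waiting x.rest
  | .loop c => .loop c :: suspended L x.waiting x.rest
  | .neighbours c n r => .neighbours c n r :: suspended L x.waiting x.rest

def state [DecidableEq V] (L : Layout G) (x : Conf V) : State V := .run x.store (x.frames L)

/-- The representatives of the classes that are being built. -/
def active (x : Conf V) : List V :=
  match x.top with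
  | .resume => x.waiting.map Prod.fst
  | .loop c => c :: x.waiting.map Prod.fst
  | .neighbours c _ _ => c :: x.waiting.map Prod.fst

/-- The node whose neighbours are being visited. -/
def current (x : Conf V) : Option V :=
  match x.top with
  | .neighbours _ n _ => some n
  | _ => none

/-- The loops on the stack are consistent with the store. -/
def StackInv (G : PreLambdaDAG V A) (x : Conf V) : Prop :=
  match x.top with
  | .resume => Waits G x.store x.visited x.popped none x.waiting
  | .loop c => Waits G x.store x.visited x.popped (some c) x.waiting
  | .neighbours c n r => Waits G x.store x.visited x.popped (some c) x.waiting ∧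
      x.store.canonic n = some c ∧ n ∈ x.visited ∧ (∀ m ∈ r, m ∈ x.store.sim n) ∧
      (∀ m ∈ x.store.sim n, m ∈ r ∨ x.store.canonic m = some c)

/-- The invariant of the blind check. -/
structure Inv [DecidableEq V] (G : PreLambdaDAG V A) (qs : List (V × V)) (E : V → V → Prop) (x : Conf V) :
    Prop where
  core : Core G qs E x.store x.visited x.popped x.active x.current
  stack : x.StackInv G
  pending : ∀ n ∈ x.popped, n ∉ x.visited → ∃ w ∈ x.waiting, w.2.1 = n
  main : ∀ n, n ∈ x.rest ∨ ∃ c, x.store.canonic n = some c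

variable [DecidableEq V] {qs : List (V × V)} {E : V → V → Prop}
  {σ : Store V} {W : List (V × V × List V)} {rest : List V} {P D : Finset V}

theorem Inv.rel {x : Conf V} (h : Inv G qs E x) {n c : V} (hn : x.store.canonic n = some c) :
    E n c := (h.core.canonic n c hn).2.1

theorem inv_enter (hE : Equivalence E) {m : V} (hm : σ.canonic m = none)
    (hc : Core G qs E σ P D (W.map Prod.fst) none) (hW : Waits G σ P D (some m) W)
    (hp : ∀ n ∈ D, n ∉ P → ∃ w ∈ W, w.2.1 = n)
    (hr : ∀ n, n ∈ rest ∨ n = m ∨ ∃ c, σ.canonic n = some c) :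
    Inv G qs E ⟨σ.enter m, W, rest, .loop m, P, D⟩ := by
  have hx := hc.extends_enter hm
  refine ⟨hc.enter hE hm, hW.mono hx subset_rfl fun _ _ h => h, hp, fun n => ?_⟩
  rcases hr n with h | rfl | ⟨c, h⟩
  · exact .inl h
  · exact .inr ⟨n, by simp [Store.enter, Store.putQueue, Store.putBuilding, Store.putCanonic]⟩
  · exact .inr ⟨c, hx.canonic _ _ h⟩

theorem sim_enter (σ : Store V) (m : V) : (σ.enter m).sim = σ.sim := rfl

/-! ### The linear potential -/

variable [Fintype V]

/-- The 2 pays for leaving the while loop and unsetting the flag. The 3 pays for leaving the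
neighbour loop, plus the 2 of the while loop to which it returns. -/
def topPotential : Top V → ℕ
  | .resume => 0
  | .loop _ => 2
  | .neighbours _ _ r => r.length + 3

/-- The number of nodes whose canonic node is undefined. -/
def undefined (σ : Store V) : ℕ := (Finset.univ.filter fun n => σ.canonic n = none).card

/-- A bound on the number of transitions that the blind check can still make. -/
def potential (L : Layout G) (x : Conf V) : ℕ :=
  8 * undefined x.store + ∑ n ∈ x.poppedᶜ, ((L.parents n).length + 3) +
    ∑ n ∈ x.visitedᶜ, (x.store.sim n).length +
    (x.waiting.map fun w => w.2.2.length + 4).sum + topPotential x.top + x.rest.length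

theorem undefined_update {σ σ' : Store V} {m c : V} (hm : σ.canonic m = none)
    (h : σ'.canonic = Function.update σ.canonic m (some c)) :
    undefined σ' + 1 = undefined σ := by
  have : (Finset.univ.filter fun n => σ'.canonic n = none) =
      (Finset.univ.filter fun n => σ.canonic n = none).erase m := by
    ext n
    by_cases hn : n = m <;> simp [h, hn]
  rw [undefined, undefined, this]
  exact Finset.card_erase_add_one (by simp [hm])

theorem sum_compl_insert (f : V → ℕ) {S : Finset V} {n : V} (hn : n ∉ S) :
    ∑ k ∈ (insert n S)ᶜ, f k + f n = ∑ k ∈ Sᶜ, f k := by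
  rw [Finset.compl_insert]
  exact Finset.sum_erase_add _ _ (by simpa using hn)

variable {L : Layout G}

/-- In at least one transition a state with smaller potential that satisfies the invariant is
reached, or the machine fails and `E` is not homogeneous. -/
def Advances (L : Layout G) (qs : List (V × V)) (E : V → V → Prop) (x : Conf V) : Prop :=
  (∃ j y, 0 < j ∧ Inv G qs E y ∧ (step L)^[j] (x.state L) = y.state L ∧
    y.potential L + j ≤ x.potential L) ∨
  (∃ j, j ≤ x.potential L ∧ (step L)^[j] (x.state L) = .fail ∧ ¬ G.IsHomogeneous E)

theorem undefined_enter {m : V} (hm : σ.canonic m = none) :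
    undefined (σ.enter m) + 1 = undefined σ := undefined_update hm rfl

/-! ### Progress of the blind check -/

theorem advances_main (hE : Equivalence E) {n : V}
    (h : Inv G qs E ⟨σ, [], n :: rest, .resume, P, D⟩) :
    Advances L qs E ⟨σ, [], n :: rest, .resume, P, D⟩ := by
  refine .inl ?_
  cases hn : σ.canonic n with
  | none =>
    refine ⟨4, ⟨σ.enter n, [], rest, .loop n, P, D⟩, by simp,
      inv_enter hE hn h.core trivial h.pending fun k => ?_, ?_, ?_⟩
    · have := h.main k
      simp only [List.mem_cons] at this
      tauto
    · simp [state, frames, suspended, Function.iterate_succ, step, hn, Store.enter]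
    · have := undefined_enter hn
      simp only [potential, sim_enter, topPotential, List.length_cons]
      omega
  | some c =>
    refine ⟨1, ⟨σ, [], rest, .resume, P, D⟩, by simp,
      ⟨h.core, trivial, h.pending, fun k => ?_⟩, ?_, ?_⟩
    · rcases h.main k with hk | hk
      · rcases List.mem_cons.1 hk with rfl | hk
        · exact .inr ⟨c, hn⟩
        · exact .inl hk
      · exact .inr hk
    · simp [state, frames, suspended, step, hn]
    · simp only [potential, topPotential, List.length_cons]
      omega

/-- If the class `d` of the parent `m` is being built, it is on the stack, so it equals `c` or is a
descendant of `c` modulo `E`; as `m` is a parent of `n`, `d` is also a parent of `c`, which closes a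
cycle. Otherwise that class is completed. -/
theorem advances_parents (hG : G.IsLambdaDAG) (hE : G.IsPropagated E) {c n m : V} {r : List V}
    (h : Inv G qs E ⟨σ, (c, n, m :: r) :: W, rest, .resume, P, D⟩) :
    Advances L qs E ⟨σ, (c, n, m :: r) :: W, rest, .resume, P, D⟩ := by
  have hcore : Core G qs E σ P D (c :: W.map Prod.fst) none := h.core
  obtain ⟨h₁, h₂, h₃, h₄, h₅, -, h₇⟩ :
    Waits G σ P D none ((c, n, m :: r) :: W) := h.stack
  have hmn : G.Child m n := h₄ m (by simp)
  have hpend : ∀ k ∈ D, k ∉ P → ∃ w ∈ (c, n, r) :: W, w.2.1 = k := by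
    intro k hk hk'
    simpa using h.pending k hk hk'
  cases hm : σ.canonic m with
  | none =>
    -- Four transitions: the loop test and the three initial assignments of `BuildClass(m)`.
    refine .inl ⟨4, ⟨σ.enter m, (c, n, r) :: W, rest, .loop m, P, D⟩, by simp,
      inv_enter hE.equivalence hm hcore
        ⟨h₁, h₂, h₃, fun p hp => h₄ p (List.mem_cons_of_mem _ hp), fun p hp => ?_, ?_, h₇⟩
        hpend fun k => (h.main k).imp_right .inr, ?_, ?_⟩
    · rcases h₅ p hp with hp | hp | hp
      · rcases List.mem_cons.1 hp with rfl | hp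
        · exact .inr (.inr rfl)
        · exact .inl hp
      · exact .inr (.inl hp)
      · simp at hp
    · rintro t ht; cases ht; exact hmn
    · simp [state, frames, suspended, Function.iterate_succ, step, hm, Store.enter]
    · have := undefined_enter hm
      simp only [potential, sim_enter, topPotential, List.length_cons, List.map_cons, List.sum_cons]
      omega
  | some d =>
    rcases hcore.status m d hm with ⟨hb, hd, -⟩ | ⟨hb, -⟩
    · refine .inr ⟨1, ?_, ?_, fun hh => ?_⟩
      · simp only [potential, List.map_cons, List.sum_cons]
        omega
      · simp [state, frames, suspended, step, hm, hb]
      · have hs : G.ChildMod E d c := ⟨m, n, hE.equivalence.symm (h.rel hm),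
          hE.equivalence.symm (h.rel h₁), hmn⟩
        rcases List.mem_cons.1 hd with rfl | hd
        · exact hG.not_transGen_childMod hE hh (hE.equivalence.refl _) (.single hs)
        · exact hG.not_transGen_childMod hE hh (hE.equivalence.refl _)
            (.head hs (h₇.transGen hE.equivalence (fun _ _ h' => h.rel h') d hd))
    · refine .inl ⟨1, ⟨σ, (c, n, r) :: W, rest, .resume, P, D⟩, by simp,
        ⟨hcore, ⟨h₁, h₂, h₃, fun p hp => h₄ p (List.mem_cons_of_mem _ hp), fun p hp => ?_,
          by simp, h₇⟩, hpend, h.main⟩, ?_, ?_⟩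
      · rcases h₅ p hp with hp | hp | hp
        · rcases List.mem_cons.1 hp with rfl | hp
          · exact .inr (.inl ⟨d, hm, hb⟩)
          · exact .inl hp
        · exact .inr (.inl hp)
        · simp at hp
      · simp [state, frames, suspended, step, hm, hb]
      · simp only [potential, topPotential, List.length_cons, List.map_cons, List.sum_cons]
        omega

theorem advances_visit {c n : V} (h : Inv G qs E ⟨σ, (c, n, []) :: W, rest, .resume, P, D⟩) :
    Advances L qs E ⟨σ, (c, n, []) :: W, rest, .resume, P, D⟩ := by
  have hcore : Core G qs E σ P D (c :: W.map Prod.fst) none := h.core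
  obtain ⟨h₁, h₂, h₃, -, h₅, -, h₇⟩ : Waits G σ P D none ((c, n, []) :: W) := h.stack
  refine .inl ⟨1, ⟨σ, W, rest, .neighbours c n (σ.sim n), insert n P, D⟩, by simp,
    ⟨hcore.visit h₂ fun p hp => ?_, ⟨h₇.mono ⟨fun _ _ h => h, fun _ h => h⟩ subset_rfl
      fun w hw hwP => ?_, h₁, Finset.mem_insert_self _ _, fun _ h => h, fun _ h => .inl h⟩,
      fun k hk hk' => ?_, h.main⟩, ?_, ?_⟩
  · simpa using h₅ p hp
  · rw [Finset.mem_insert, not_or]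
    -- A second suspended loop on `n` would make its class `c` occur twice among the active classes.
    refine ⟨fun e => (List.nodup_cons.1 hcore.active_nodup).1 ?_, hwP⟩
    have := h₇.canonic w hw
    rw [e, h₁] at this
    rw [Option.some.inj this]
    exact List.mem_map_of_mem hw
  · rw [Finset.mem_insert, not_or] at hk'
    obtain ⟨w, hw, e⟩ := h.pending k hk hk'.2
    rcases List.mem_cons.1 hw with rfl | hw
    · exact (hk'.1 e.symm).elim
    · exact ⟨w, hw, e⟩
  · simp [state, frames, suspended, step]
  · have := sum_compl_insert (fun k => (σ.sim k).length) h₃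
    simp only [potential, topPotential, List.length_nil, List.map_cons, List.sum_cons]
    omega

theorem advances_loop {c : V} (h : Inv G qs E ⟨σ, W, rest, .loop c, P, D⟩) :
    Advances L qs E ⟨σ, W, rest, .loop c, P, D⟩ := by
  have hcore : Core G qs E σ P D (c :: W.map Prod.fst) none := h.core
  have hW : Waits G σ P D (some c) W := h.stack
  have hc := hcore.active c (by simp)
  refine .inl ?_
  cases hq : σ.queue c with
  | nil =>
    have hx := Core.extends_finish σ c
    refine ⟨2, ⟨σ.putBuilding c false, W, rest, .resume, P, D⟩, by simp,
      ⟨hcore.finish fun n hn => ?_, ?_, h.pending, h.main⟩, ?_, ?_⟩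
    · rcases hcore.status n c hn with ⟨-, -, hD⟩ | ⟨-, hP⟩
      · simp only [hq, List.not_mem_nil, or_false] at hD
        by_contra hP
        -- The queue is empty, so every member of the class has been popped. An unvisited one would
        -- have a suspended loop of the class `c` further down the stack, and `c` would be active
        -- twice.
        obtain ⟨w, hw, e⟩ := h.pending n hD hP
        have := hW.canonic w hw
        rw [e, hn] at this
        refine (List.nodup_cons.1 hcore.active_nodup).1 ?_
        rw [Option.some.inj this]
        exact List.mem_map_of_mem hw
      · exact hP
    · exact (hW.mono hx subset_rfl fun _ _ h => h).resume
        ⟨c, hc.2, by simp [Store.putBuilding]⟩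
    · simp [state, frames, Function.iterate_succ, step, hq]
    · have h₁ : undefined (σ.putBuilding c false) = undefined σ := rfl
      have h₂ : (σ.putBuilding c false).sim = σ.sim := rfl
      simp only [potential, topPotential, h₁, h₂]
      omega
  | cons n q =>
    obtain ⟨hn, hnD⟩ := hcore.queue c n (by simp [hq])
    refine ⟨1, ⟨σ.putQueue c q, (c, n, L.parents n) :: W, rest, .resume, P, insert n D⟩, by simp,
      ⟨hcore.pop hq, ⟨hn, Finset.mem_insert_self _ _, fun hP => hnD (hcore.subset hP),
        fun p hp => (L.mem_parents n p).1 hp, fun p hp => .inl ((L.mem_parents n p).2 hp), by simp,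
        hW.mono (Core.extends_pop _ _ _) (Finset.subset_insert _ _) fun _ _ h => h⟩,
        fun k hk hk' => ?_, h.main⟩, ?_, ?_⟩
    · rcases Finset.mem_insert.1 hk with rfl | hk
      · exact ⟨_, List.mem_cons_self, rfl⟩
      · obtain ⟨w, hw, e⟩ := h.pending k hk hk'
        exact ⟨w, List.mem_cons_of_mem _ hw, e⟩
    · simp [state, frames, suspended, step, hq]
    · have := sum_compl_insert (fun k => (L.parents k).length + 3) hnD
      have h₁ : undefined (σ.putQueue c q) = undefined σ := rfl
      have h₂ : (σ.putQueue c q).sim = σ.sim := rfl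
      simp only [potential, topPotential, h₁, h₂, List.map_cons, List.sum_cons]
      omega

theorem advances_neighbours_nil {c n : V}
    (h : Inv G qs E ⟨σ, W, rest, .neighbours c n [], P, D⟩) :
    Advances L qs E ⟨σ, W, rest, .neighbours c n [], P, D⟩ := by
  have hcore : Core G qs E σ P D (c :: W.map Prod.fst) (some n) := h.core
  obtain ⟨hW, hn, -, -, hs⟩ := h.stack
  refine .inl ⟨1, ⟨σ, W, rest, .loop c, P, D⟩, by simp,
    ⟨hcore.leave fun m hm => ?_, hW, h.pending, h.main⟩, ?_, ?_⟩
  · exact ((hs m hm).resolve_left (by simp)).trans hn.symm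
  · simp [state, frames, step]
  · simp only [potential, topPotential, List.length_nil]
    omega

/-- Suppose the neighbour `m` is in a class `d ≠ c`. If `d` is being built, it is a proper
descendant of `c` modulo `E` while `E c d` holds, a cycle. If `d` is completed, the finished visit
of `m` already gave `n` the same class, since query edges are symmetric; so this case cannot occur.
-/
theorem advances_neighbours_cons (hG : G.IsLambdaDAG) (hE : G.IsPropagated E) {c n m : V}
    {r : List V} (h : Inv G qs E ⟨σ, W, rest, .neighbours c n (m :: r), P, D⟩) :
    Advances L qs E ⟨σ, W, rest, .neighbours c n (m :: r), P, D⟩ := by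
  have hcore : Core G qs E σ P D (c :: W.map Prod.fst) (some n) := h.core
  obtain ⟨hW, hn, hnP, hr, hs⟩ := h.stack
  have hmn : m ∈ σ.sim n := hr m (by simp)
  have hmc : E m c := hE.equivalence.trans (hE.equivalence.symm (hcore.sim_rel n m hmn)) (h.rel hn)
  cases hm : σ.canonic m with
  | none =>
    cases hp : propagate G σ m c with
    | none =>
      refine .inr ⟨2, ?_, ?_, fun hh => not_homogeneous_of_propagate_eq_none hp (hh _ _ hmc)⟩
      · simp only [potential, topPotential]
        omega
      · simp [state, frames, Function.iterate_succ, step, hm, hp]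
    | some σ' =>
      have hp' := propagates_of_propagate_eq_some hp
      have hx := Core.extends_enroll hm hp'
      have hsim := hcore.sim_enroll_eq hm hp' List.mem_cons_self hnP
      refine .inl ⟨4, ⟨σ'.enroll m c, W, rest, .neighbours c n r, P, D⟩, by simp,
        ⟨hcore.enroll hE hm hp' List.mem_cons_self hmc, ⟨hW.mono hx subset_rfl fun _ _ h => h,
          hx.canonic _ _ hn, hnP, fun k hk => ?_, fun k hk => ?_⟩, h.pending,
          fun k => (h.main k).imp_right fun ⟨d, hd⟩ => ⟨d, hx.canonic _ _ hd⟩⟩, ?_, ?_⟩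
      · exact hsim ▸ hr k (List.mem_cons_of_mem _ hk)
      · rcases hs k (hsim ▸ hk) with hk | hk
        · rcases List.mem_cons.1 hk with rfl | hk
          · exact .inr (by simp [Store.enroll, Store.putQueue, Store.putCanonic])
          · exact .inl hk
        · exact .inr (hx.canonic _ _ hk)
      · simp [state, frames, Function.iterate_succ, step, hm, hp, Store.enroll, Store.putCanonic]
      -- The 8 units released by `m` cover the four transitions and the at most four new list
      -- entries.
      · have h₁ : undefined (σ'.enroll m c) + 1 = undefined σ := undefined_update (c := c) hm (by
          simp [Store.enroll, Store.putQueue, Store.putCanonic, hp'.canonic])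
        have h₂ : ∑ k ∈ Pᶜ, ((σ'.enroll m c).sim k).length ≤ ∑ k ∈ Pᶜ, (σ.sim k).length + 4 :=
          hp'.sum_le Pᶜ
        simp only [potential, topPotential, List.length_cons]
        omega
  | some d =>
    by_cases hd : d = c
    · subst hd
      refine .inl ⟨1, ⟨σ, W, rest, .neighbours d n r, P, D⟩, by simp,
        ⟨hcore, ⟨hW, hn, hnP, fun k hk => hr k (List.mem_cons_of_mem _ hk), fun k hk => ?_⟩,
          h.pending, h.main⟩, ?_, ?_⟩
      · rcases hs k hk with hk | hk
        · rcases List.mem_cons.1 hk with rfl | hk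
          · exact .inr hm
          · exact .inl hk
        · exact .inr hk
      · simp [state, frames, step, hm]
      · simp only [potential, topPotential, List.length_cons]
        omega
    · refine .inr ⟨1, ?_, ?_, fun hh => ?_⟩
      · simp only [potential, topPotential]
        omega
      · simp [state, frames, step, hm, hd]
      · rcases hcore.status m d hm with ⟨-, hd', -⟩ | ⟨-, hmP⟩
        · exact hG.not_transGen_childMod hE hh
            (hE.equivalence.trans (hE.equivalence.symm hmc) (h.rel hm))
            (hW.transGen hE.equivalence (fun _ _ h' => h.rel h') d
              ((List.mem_cons.1 hd').resolve_left hd))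
        · have hne : n ≠ m := by
            rintro rfl
            rw [hn] at hm
            exact hd (Option.some.inj hm).symm
          have := hcore.sim_done m hmP (by simpa using hne) n (hcore.sim_symm n m hmn)
          rw [hn, hm] at this
          exact hd (Option.some.inj this).symm

/-- The blind check is over. -/
def IsFinal (x : Conf V) : Prop := x.top = .resume ∧ x.waiting = [] ∧ x.rest = []

theorem advances_or_isFinal (hG : G.IsLambdaDAG) (hE : G.IsPropagated E) {x : Conf V}
    (h : Inv G qs E x) : Advances L qs E x ∨ x.IsFinal := by
  obtain ⟨σ, W, rest, top, P, D⟩ := x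
  cases top with
  | resume =>
    cases W with
    | nil =>
      cases rest with
      | nil => exact .inr ⟨rfl, rfl, rfl⟩
      | cons n rest => exact .inl (advances_main hE.equivalence h)
    | cons w W =>
      obtain ⟨c, n, r⟩ := w
      cases r with
      | nil => exact .inl (advances_visit h)
      | cons m r => exact .inl (advances_parents hG hE h)
  | loop c => exact .inl (advances_loop h)
  | neighbours c n r =>
    cases r with
    | nil => exact .inl (advances_neighbours_nil h)
    | cons m r => exact .inl (advances_neighbours_cons hG hE h)

theorem exists_isFinal (hG : G.IsLambdaDAG) (hE : G.IsPropagated E) {x : Conf V}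
    (h : Inv G qs E x) :
    (∃ t y, t ≤ x.potential L ∧ Inv G qs E y ∧ y.IsFinal ∧
      (step L)^[t] (x.state L) = y.state L) ∨
    (∃ t, t ≤ x.potential L ∧ (step L)^[t] (x.state L) = .fail ∧ ¬ G.IsHomogeneous E) := by
  induction hN : x.potential L using Nat.strong_induction_on generalizing x with
  | _ N ih =>
    subst hN
    rcases advances_or_isFinal (L := L) hG hE h with (⟨j, y, hj, hy, hxy, hle⟩ | hf) | hf
    · rcases ih _ (by omega) hy rfl with ⟨t, z, ht, hz, hzf, hyz⟩ | ⟨t, ht, hyz, hh⟩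
      · refine .inl ⟨t + j, z, by omega, hz, hzf, ?_⟩
        rw [Function.iterate_add_apply, hxy, hyz]
      · refine .inr ⟨t + j, by omega, ?_, hh⟩
        rw [Function.iterate_add_apply, hxy, hyz]
    · exact .inr hf
    · exact .inl ⟨0, x, by simp, h, hf, rfl⟩

end Conf

end SharingEquality

namespace SharingEquality

open PreLambdaDAG

variable {V : Type u} {A : Type v} {G : PreLambdaDAG V A}

/-! ### The state after the blind check -/

/-- The properties of the store after the blind check. -/
structure Complete (G : PreLambdaDAG V A) (Q E : V → V → Prop) (σ : Store V) : Prop where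
  canonic : ∀ n, ∃ c, σ.canonic n = some c ∧ σ.canonic c = some c ∧ E n c ∧
    (G.node n).Homogeneous (G.node c) ∧
    ∀ x ∈ G.childPairs n c, σ.canonic x.1 = σ.canonic x.2
  query : ∀ n m, Q n m → σ.canonic n = σ.canonic m

namespace Complete

variable {Q E : V → V → Prop} {σ : Store V}

theorem canonic_spec (h : Complete G Q E σ) {n c : V} (hn : σ.canonic n = some c) :
    σ.canonic c = some c ∧ E n c ∧ (G.node n).Homogeneous (G.node c) ∧
      ∀ x ∈ G.childPairs n c, σ.canonic x.1 = σ.canonic x.2 := by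
  obtain ⟨c', hc', h'⟩ := h.canonic n
  rw [hn] at hc'
  cases hc'
  exact h'

theorem sameCanonic_iff (h : Complete G Q E σ) {n m : V} :
    SameCanonic σ.canonic n m ↔ σ.canonic n = σ.canonic m := by
  obtain ⟨c, hc, -⟩ := h.canonic n
  constructor
  · rintro ⟨r, h₁, h₂⟩; rw [h₁, h₂]
  · intro e; exact ⟨c, hc, e ▸ hc⟩

theorem isHomogeneous (h : Complete G Q E σ) : G.IsHomogeneous (SameCanonic σ.canonic) := by
  rintro n m ⟨r, h₁, h₂⟩
  exact (h.canonic_spec h₁).2.2.1.trans (h.canonic_spec h₂).2.2.1.symm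

/-- Propagation from each node to its canonic node suffices: two nodes of a class are compared
through the children of their common representative. -/
theorem isPropagated (h : Complete G Q E σ) : G.IsPropagated (SameCanonic σ.canonic) where
  equivalence :=
    ⟨fun _ => h.sameCanonic_iff.2 rfl,
      fun hnm => h.sameCanonic_iff.2 (h.sameCanonic_iff.1 hnm).symm,
      fun hnm hmk => h.sameCanonic_iff.2
        ((h.sameCanonic_iff.1 hnm).trans (h.sameCanonic_iff.1 hmk))⟩
  down := by
    rintro n m ⟨r, h₁, h₂⟩ _ x hx
    obtain ⟨-, -, hh, h₃⟩ := h.canonic_spec h₁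
    obtain ⟨b, hb, hb'⟩ := exists_childPairs_between hh hx
    exact h.sameCanonic_iff.2 ((h₃ _ hb).trans
      ((h.canonic_spec h₂).2.2.2 _ (childPairs_swap hb')).symm)

theorem rel_of_sameCanonic (h : Complete G Q E σ) (hE : Equivalence E) {n m : V}
    (hnm : SameCanonic σ.canonic n m) : E n m := by
  obtain ⟨r, h₁, h₂⟩ := hnm
  exact hE.trans (h.canonic_spec h₁).2.1 (hE.symm (h.canonic_spec h₂).2.1)

variable [DecidableEq V]

theorem isSharingEquivalence (h : Complete G Q E σ)
    (hp : ∀ w, (G.node w).isVar → varPasses G σ w) :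
    G.IsSharingEquivalence (SameCanonic σ.canonic) := by
  refine h.isPropagated.isSharingEquivalence h.isHomogeneous ?_ ?_
  · have key : ∀ n r l, σ.canonic n = some r → G.node n = .bvar l →
        ∃ k, G.node r = .bvar k ∧ σ.canonic l = σ.canonic k := by
      intro n r l hr hn
      have hpn := hp n (by simp [hn, Node.isVar])
      have hh := (h.canonic_spec hr).2.2.1
      by_cases hnr : n = r
      · exact ⟨l, hnr ▸ hn, rfl⟩
      · rw [hn] at hh
        cases hrn : G.node r <;> rw [hrn] at hh <;> try exact hh.elim
        rename_i k
        simp only [varPasses, hr, hnr, if_false, hn, hrn, Node.binder, decide_eq_true_eq] at hpn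
        exact ⟨k, rfl, hpn⟩
    rintro n m l l' ⟨r, h₁, h₂⟩ hn hm
    obtain ⟨k, hk, e⟩ := key n r l h₁ hn
    obtain ⟨k', hk', e'⟩ := key m r l' h₂ hm
    rw [hk] at hk'
    cases hk'
    exact h.sameCanonic_iff.2 (e.trans e'.symm)
  · have key : ∀ n r a, σ.canonic n = some r → G.node n = .fvar a → n = r := by
      intro n r a hr hn
      have hpn := hp n (by simp [hn, Node.isVar])
      by_contra hnr
      simp [varPasses, hr, hnr, hn, Node.binder] at hpn
    rintro n m a a' ⟨r, h₁, h₂⟩ hn hm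
    rw [key n r a h₁ hn, key m r a' h₂ hm]

/-- If some sharing equivalence contains the query, then the variables check passes. -/
theorem varPasses_of_isSharingEquivalence (hG : G.IsLambdaDAG) (hq : G.IsQuery Q)
    {R : V → V → Prop} (hR : G.IsSharingEquivalence R) (hQ : ∀ n m, Q n m → R n m)
    (h : Complete G Q (Relation.EqvGen (G.SameTrace Q)) σ) {w : V} (hw : (G.node w).isVar) :
    varPasses G σ w := by
  obtain ⟨r, hr, -, hE, hh, -⟩ := h.canonic w
  by_cases hwr : w = r
  · simp [varPasses, hr, hwr.symm]
  · cases hn : G.node w with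
    | app _ _ => simp [hn, Node.isVar] at hw
    | abs _ => simp [hn, Node.isVar] at hw
    | fvar a =>
      rw [hn] at hh
      cases hrn : G.node r <;> rw [hrn] at hh <;> try exact hh.elim
      exact (hwr (hR.isOpen _ _ _ _
        (eqvGen_sameTrace_le hR.isPropagated hR.homogeneous hQ hE) hn hrn)).elim
    | bvar l =>
      rw [hn] at hh
      cases hrn : G.node r <;> rw [hrn] at hh <;> try exact hh.elim
      rename_i k
      have hlk := eqvGen_sameTrace_binder hG hq hR hQ hE hn hrn
      -- The relation of equal canonics is itself homogeneous, propagated and contains the query, so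
      -- it contains the spreading; the two relations coincide, and scoping passes to the canonics.
      have := eqvGen_sameTrace_le h.isPropagated h.isHomogeneous
        (fun n m hnm => h.sameCanonic_iff.2 (h.query n m hnm)) hlk
      simpa [varPasses, hr, hwr, hn, hrn, Node.binder] using h.sameCanonic_iff.1 this

end Complete

/-! ### The combined algorithm -/

variable [DecidableEq V] {L : Layout G} {qs : List (V × V)}

theorem exists_loaded (L : Layout G) (qs : List (V × V)) (σ : Store V) (k : List (Frame V)) :
    ∃ σ' : Store V, (step L)^[qs.length + 1] (.run σ (.load qs :: k)) = .run σ' k ∧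
      σ'.canonic = σ.canonic ∧ σ'.building = σ.building ∧ σ'.queue = σ.queue ∧
      (∀ a b, b ∈ σ'.sim a ↔ b ∈ σ.sim a ∨ (a, b) ∈ qs ∨ (b, a) ∈ qs) ∧
      ∀ S : Finset V, ∑ a ∈ S, (σ'.sim a).length ≤ ∑ a ∈ S, (σ.sim a).length + 2 * qs.length := by
  induction qs generalizing σ with
  | nil => exact ⟨σ, rfl, rfl, rfl, rfl, by simp, by simp⟩
  | cons q qs ih =>
    obtain ⟨n, m⟩ := q
    obtain ⟨σ', h₁, h₂, h₃, h₄, h₅, h₆⟩ := ih (σ.addEdge n m)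
    refine ⟨σ', ?_, h₂, h₃, h₄, fun a b => ?_, fun S => ?_⟩
    · rw [List.length_cons, Function.iterate_succ_apply]
      exact h₁
    · rw [h₅, Store.mem_sim_addEdge]
      simp only [List.mem_cons, Prod.mk.injEq]
      tauto
    · have := h₆ S
      have := σ.sum_length_sim_addEdge_le n m S
      rw [List.length_cons]
      omega

theorem exists_vars (L : Layout G) (σ : Store V) (ws : List V) :
    ∃ t ≤ ws.length + 1,
      ((step L)^[t] (.run σ [.vars ws]) = .fail ∧
        ∃ w, (G.node w).isVar ∧ ¬ varPasses G σ w) ∨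
      ((step L)^[t] (.run σ [.vars ws]) = .run σ [] ∧
        ∀ w ∈ ws, (G.node w).isVar → varPasses G σ w) := by
  induction ws with
  | nil => exact ⟨1, by simp, .inr ⟨rfl, by simp⟩⟩
  | cons w ws ih =>
    by_cases hw : (G.node w).isVar ∧ ¬ varPasses G σ w
    · exact ⟨1, by simp, .inl ⟨by simp [step, hw.1, hw.2], w, hw⟩⟩
    · obtain ⟨t, ht, h⟩ := ih
      have hs : step L (.run σ [.vars (w :: ws)]) = .run σ [.vars ws] := by
        by_cases h₁ : (G.node w).isVar
        · have h₂ : varPasses G σ w := by by_contra h₂; exact hw ⟨h₁, h₂⟩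
          simp [step, h₁, h₂]
        · simp [step, h₁]
      refine ⟨t + 1, by simpa using ht, ?_⟩
      rw [Function.iterate_succ_apply, hs]
      refine h.imp_right fun ⟨h₁, h₂⟩ => ⟨h₁, fun k hk hv => ?_⟩
      rcases List.mem_cons.1 hk with rfl | hk
      · by_contra h₃; exact hw ⟨hv, h₃⟩
      · exact h₂ k hk hv

theorem Conf.Inv.complete {Q E : V → V → Prop} (hqs : ∀ n m, (n, m) ∈ qs ↔ Q n m) {x : Conf V}
    (h : Conf.Inv G qs E x) (hx : x.IsFinal) : Complete G Q E x.store := by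
  obtain ⟨σ, W, rest, top, P, D⟩ := x
  obtain ⟨rfl, rfl, rfl⟩ := hx
  have hcore : Core G qs E σ P D [] none := h.core
  have hdef : ∀ n, ∃ c, σ.canonic n = some c := fun n => (h.main n).resolve_left (by simp)
  have hsim : ∀ n m, m ∈ σ.sim n → σ.canonic n = σ.canonic m := by
    intro n m hm
    obtain ⟨c, hc⟩ := hdef n
    rcases hcore.status n c hc with ⟨-, h', -⟩ | ⟨-, hP⟩
    · simp at h'
    · exact (hcore.sim_done n hP (by simp) m hm).symm
  refine ⟨fun n => ?_, fun n m hnm => hsim n m (hcore.query n m ((hqs n m).2 hnm))⟩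
  obtain ⟨c, hc⟩ := hdef n
  obtain ⟨h₁, h₂, h₃, h₄⟩ := hcore.canonic n c hc
  refine ⟨c, hc, h₁, h₂, h₃, fun x hx => ?_⟩
  rcases h₄ with rfl | h₄
  · rw [fst_eq_snd_of_mem_childPairs hx]
  · exact hsim _ _ (h₄ x hx)

theorem Conf.inv_initial {E : V → V → Prop} (hE : Equivalence E) (hQ : ∀ n m, (n, m) ∈ qs → E n m)
    {σ : Store V} (h₁ : σ.canonic = fun _ => none) (h₂ : σ.queue = fun _ => [])
    (h₃ : ∀ a b, b ∈ σ.sim a ↔ (a, b) ∈ qs ∨ (b, a) ∈ qs) :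
    Conf.Inv G qs E ⟨σ, [], L.nodes, .resume, ∅, ∅⟩ := by
  refine ⟨⟨by simp [h₁], fun a b => ?_, fun a b => ?_, fun a b hab => (h₃ a b).2 (.inl hab),
    by simp, by simp, by simp, by simp, by simp [h₁], ?_, ?_, by simp [h₂], by simp [h₂]⟩,
    trivial, by simp, fun n => .inl (L.mem_nodes n)⟩
  · rw [h₃, h₃]; exact Or.symm
  · rw [h₃]
    rintro (h | h)
    · exact hQ _ _ h
    · exact hE.symm (hQ _ _ h)
  · exact fun c hc => (List.not_mem_nil hc).elim
  · exact List.nodup_nil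

/-! ### Size estimates and the complete run -/

variable [Fintype V]

theorem Layout.length_nodes (L : Layout G) : L.nodes.length = Fintype.card V := by
  rw [← List.toFinset_card_of_nodup L.nodes_nodup, ← Finset.card_univ]
  congr 1
  ext n
  simp [L.mem_nodes]

theorem _root_.List.sum_count_eq_length {α : Type*} [Fintype α] [DecidableEq α] (l : List α) :
    ∑ a, l.count a = l.length := by
  have := Multiset.sum_count_eq_card (s := Finset.univ) (m := (l : Multiset α)) (by simp)
  simpa using this

/-- Double counting: the entries of all parent arrays are at most the non-binding edges. -/
theorem Layout.sum_length_parents_le (L : Layout G) :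
    ∑ n, (L.parents n).length ≤ ∑ n, (G.node n).outDegree :=
  calc ∑ n, (L.parents n).length = ∑ n, ∑ m, (L.parents n).count m := by
        simp_rw [List.sum_count_eq_length]
    _ ≤ ∑ n, ∑ m, (G.node m).children.count n :=
        Finset.sum_le_sum fun n _ => Finset.sum_le_sum fun m _ => L.count_parents n m
    _ = ∑ m, (G.node m).children.length := by
        rw [Finset.sum_comm]
        simp_rw [List.sum_count_eq_length]
    _ ≤ ∑ n, (G.node n).outDegree :=
        Finset.sum_le_sum fun n _ => Node.length_children_le_outDegree _

/-- The outcome of a run of the combined algorithm, with respect to a propagated equivalence that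
contains the query. -/
theorem exists_outcome (hG : G.IsLambdaDAG) {Q E : V → V → Prop} (hE : G.IsPropagated E)
    (hQ : ∀ n m, Q n m → E n m) (L : Layout G) (hqs : ∀ n m, (n, m) ∈ qs ↔ Q n m) :
    ∃ t ≤ 14 * (G.size + qs.length + 1),
      (stateAfter L qs t = .fail ∧ (¬ G.IsHomogeneous E ∨
        ∃ σ, Complete G Q E σ ∧ ∃ w, (G.node w).isVar ∧ ¬ varPasses G σ w)) ∨
      ∃ σ, stateAfter L qs t = .run σ [] ∧ Complete G Q E σ ∧
        ∀ w, (G.node w).isVar → varPasses G σ w := by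
  obtain ⟨σ, h₁, h₂, h₃, h₄, h₅, h₆⟩ :=
    exists_loaded L qs Store.empty [.main L.nodes, .vars L.nodes]
  have hinv : Conf.Inv G qs E ⟨σ, [], L.nodes, .resume, ∅, ∅⟩ :=
    Conf.inv_initial hE.equivalence (fun n m h => hQ _ _ ((hqs n m).1 h)) h₂ h₄
      (by simpa [Store.empty] using h₅)
  -- The initial potential is at most `12 * card V` plus the number of edges plus `2 * qs.length`.
  -- Loading and the variables check add `qs.length + card V`, and the exits of the loading, main
  -- and variables loops add 3.
  have hpot : Conf.potential L ⟨σ, [], L.nodes, .resume, ∅, ∅⟩ + qs.length + L.nodes.length + 3 ≤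
      14 * (G.size + qs.length + 1) := by
    have hu : Conf.undefined σ ≤ Fintype.card V := Finset.card_filter_le _ _
    have hs := h₆ Finset.univ
    have hp := L.sum_length_parents_le
    simp only [Store.empty, List.length_nil, Finset.sum_const_zero, zero_add] at hs
    simp only [Conf.potential, Conf.topPotential, Finset.compl_empty, Finset.sum_add_distrib,
      Finset.sum_const, Finset.card_univ, smul_eq_mul, List.map_nil, List.sum_nil, L.length_nodes,
      size]
    omega
  have hstart : ∀ t, stateAfter L qs (t + (qs.length + 1)) =
      (step L)^[t] (Conf.state L ⟨σ, [], L.nodes, .resume, ∅, ∅⟩) := by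
    intro t
    rw [stateAfter, Function.iterate_add_apply, initialState, h₁]
    rfl
  rcases Conf.exists_isFinal (L := L) hG hE hinv with ⟨t, y, ht, hy, hyf, hst⟩ | ⟨t, ht, hst, hh⟩
  · have hc := hy.complete hqs hyf
    have hy' : step L (y.state L) = .run y.store [.vars L.nodes] := by
      obtain ⟨σ, W, rest, top, P, D⟩ := y
      obtain ⟨rfl, rfl, rfl⟩ := hyf
      rfl
    obtain ⟨s, hs, h⟩ := exists_vars L y.store L.nodes
    have hrun : stateAfter L qs (s + 1 + t + (qs.length + 1)) =
        (step L)^[s] (.run y.store [.vars L.nodes]) := by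
      rw [hstart, Function.iterate_add_apply, hst, Function.iterate_succ_apply, hy']
    refine ⟨s + 1 + t + (qs.length + 1), by omega, ?_⟩
    rw [hrun]
    rcases h with ⟨h, hw⟩ | ⟨h, hw⟩
    · exact .inl ⟨h, .inr ⟨_, hc, hw⟩⟩
    · exact .inr ⟨_, h, hc, fun w => hw w (L.mem_nodes w)⟩
  · exact ⟨t + (qs.length + 1), by omega, .inl ⟨(hstart t).trans hst, .inl hh⟩⟩

omit [Fintype V] in
-- A state fixed by `step` persists, so both states are the one at time `s + t`.
theorem stateAfter_eq_of_step_eq {s t : ℕ}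
    (hs : step L (stateAfter L qs s) = stateAfter L qs s)
    (ht : step L (stateAfter L qs t) = stateAfter L qs t) :
    stateAfter L qs s = stateAfter L qs t := by
  have key : ∀ {s : ℕ}, step L (stateAfter L qs s) = stateAfter L qs s →
      ∀ k, stateAfter L qs (k + s) = stateAfter L qs s := fun hs k => by
    have := Function.iterate_fixed hs k
    rwa [stateAfter, Function.iterate_add_apply]
  rw [← key hs t, ← key ht s, Nat.add_comm]

/-- The machine is deterministic, so the given output is that of the run in `exists_outcome`. The
same `c` can thus be analysed with any choice of `E`. -/
theorem Outputs.complete (hG : G.IsLambdaDAG) {Q E : V → V → Prop} (hE : G.IsPropagated E)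
    (hQ : ∀ n m, Q n m → E n m) (hqs : ∀ n m, (n, m) ∈ qs ↔ Q n m) {c : V → Option V}
    (h : Outputs L qs c) :
    ∃ σ, σ.canonic = c ∧ Complete G Q E σ ∧ ∀ w, (G.node w).isVar → varPasses G σ w := by
  obtain ⟨t, σ, ht, rfl⟩ := h
  obtain ⟨s, -, ⟨hs, -⟩ | ⟨σ', hs, h⟩⟩ := exists_outcome hG hE hQ L hqs
  all_goals
    have e := stateAfter_eq_of_step_eq (L := L) (qs := qs) (s := s) (t := t) (by rw [hs]; rfl)
      (by rw [ht]; rfl)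
    rw [hs, ht] at e
    cases e
  exact ⟨_, rfl, h⟩

omit [DecidableEq V] in
theorem ncard_canonicEdges_le (c : V → Option V) : (canonicEdges c).ncard ≤ Fintype.card V := by
  -- The default value `n` is irrelevant: only nodes with a defined canonic contribute edges.
  have hsub : canonicEdges c ⊆ (fun n => (n, (c n).getD n)) '' Set.univ := by
    rintro ⟨n, m⟩ h
    have h : c n = some m := h
    exact ⟨n, trivial, by simp [h]⟩
  refine (Set.ncard_le_ncard hsub (Set.toFinite _)).trans ((Set.ncard_image_le).trans ?_)
  rw [Set.ncard_univ, Nat.card_eq_fintype_card]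

end SharingEquality

/-! ### Conclusion -/

theorem mainTheorem1 :
    ∃ C : ℕ, ∀ (V : Type u) [Fintype V] [DecidableEq V] (A : Type v)
      (G : PreLambdaDAG V A), G.IsLambdaDAG →
      ∀ Q : V → V → Prop, G.IsQuery Q →
      ∀ (L : Layout G) (qs : List (V × V)), (∀ n m, (n, m) ∈ qs ↔ Q n m) →
        -- the running time is linear
        (∃ t : ℕ, t ≤ C * (G.size + qs.length + 1) ∧ HaltsWithin L qs t) ∧
        -- success characterises the existence of a sharing equivalence that contains the query
        (Succeeds L qs ↔ ∃ R : V → V → Prop, G.IsSharingEquivalence R ∧ ∀ n m, Q n m → R n m) ∧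
        -- the output: one canonic pointer per node, representing the smallest one
        (∀ c : V → Option V, Outputs L qs c →
          IsLeast (G.sharingEquivalencesOver Q) (SameCanonic c) ∧
          (∀ n, ∃ r, c n = some r ∧ c r = some r) ∧
          (canonicEdges c).ncard ≤ G.size) := by
  refine ⟨14, fun V _ _ A G hG Q hq L qs hqs => ?_⟩
  -- Propagation does not require homogeneity, so the total relation qualifies; it serves for the
  -- claims that presuppose no sharing equivalence.
  have htrue : G.IsPropagated fun _ _ => True :=
    ⟨⟨fun _ => trivial, fun _ => trivial, fun _ _ => trivial⟩, fun _ _ _ _ _ _ => trivial⟩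
  have hmem : ∀ c, Outputs L qs c → SameCanonic c ∈ G.sharingEquivalencesOver Q := by
    intro c hc
    obtain ⟨σ, rfl, h, hv⟩ := hc.complete hG htrue (fun _ _ _ => trivial) hqs
    exact ⟨h.isSharingEquivalence hv, fun n m hnm => h.sameCanonic_iff.2 (h.query n m hnm)⟩
  refine ⟨?_, ⟨?_, ?_⟩, fun c hc => ⟨⟨hmem c hc, ?_⟩, fun n => ?_, ?_⟩⟩
  · obtain ⟨t, ht, ⟨h, -⟩ | ⟨σ, h, -⟩⟩ :=
      exists_outcome hG htrue (Q := Q) (fun _ _ _ => trivial) L hqs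
    · exact ⟨t, ht, .inl h⟩
    · exact ⟨t, ht, .inr ⟨σ, h⟩⟩
  · rintro ⟨c, hc⟩
    exact ⟨_, hmem c hc⟩
  · rintro ⟨R, hR, hQR⟩
    -- With the spreading of the query as `E`, both kinds of failure are refuted: it is contained in
    -- `R`, and it respects binders.
    obtain ⟨t, -, ⟨-, hh | ⟨σ, h, w, hw, hf⟩⟩ | ⟨σ, h, -⟩⟩ :=
      exists_outcome hG (PreLambdaDAG.isPropagated_eqvGen_sameTrace hR hQR) (Q := Q)
        (fun n m hnm => .rel _ _ ⟨n, m, [], hnm, .nil n, .nil m⟩) L hqs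
    · exact (hh fun n m h => hR.homogeneous n m
        (PreLambdaDAG.eqvGen_sameTrace_le hR.isPropagated hR.homogeneous hQR h)).elim
    · exact (hf (Complete.varPasses_of_isSharingEquivalence hG hq hR hQR h hw)).elim
    · exact ⟨_, t, σ, h, rfl⟩
  · rintro R ⟨hR, hQR⟩ n m hnm
    -- Minimality: with `E := R`, every canonic edge of the run lies in `R`.
    obtain ⟨σ, rfl, h, -⟩ := hc.complete hG hR.isPropagated hQR hqs
    exact h.rel_of_sameCanonic hR.equivalence hnm
  · obtain ⟨σ, rfl, h, -⟩ := hc.complete hG htrue (fun _ _ _ => trivial) hqs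
    obtain ⟨r, h₁, h₂, -⟩ := h.canonic n
    exact ⟨r, h₁, h₂⟩
  · exact (ncard_canonicEdges_le c).trans (Nat.le_add_right _ _)
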